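/- **Setting.** Let $\mathbb H$ be the open upper half-plane and let $\varphi:\mathbb R\to\mathbb C$ be an inner function, i.e. $\varphi$ is the almost-everywhere boundary value $\varphi(x)=\lim_{y\downarrow0}\Phi(x+iy)$ of a bounded analytic function $\Phi$ on $\mathbb H$, and $|\varphi(p)|=1$ for almost every $p\in\mathbb R$. (No symmetry of $\varphi$ is assumed.) Put $\check\varphi(p)=\overline{\varphi(-p)}$. *Fermionic space and scattering operator.* Let $\mathcal H^1=\mathcal H_+\oplus\mathcal H_-$ with $\mathcal H_\pm=L^2(\mathbb R_+,2\pi\,dp)$ be the one-particle space of the free complex fermion in momentum space, let $P_1=P_+\oplus P_-$ be the operator of multiplication by $p$ on it, and let $\mathcal F$ be the antisymmetric Fock space over $\mathcal H^1$. On $\mathcal H^1\otimes\mathcal H^1$ set $$M_\varphi=\varphi(P_+\otimes P_+)\oplus\check\varphi(P_+\otimes P_-)\oplus\check\varphi(P_-\otimes P_+)\oplus\varphi(P_-\otimes P_-).$$ Let $(M_\varphi)_{i,j}$ denote $M_\varphi$ acting on the $i$-th factor of $(\mathcal H^1)^{\otimes m}$ and the $j$-th factor of $(\mathcal H^1)^{\otimes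 n}$, and let $S_\varphi$ be the restriction of $\bigoplus_{m,n\ge0}\prod_{i,j}(M_\varphi)_{i,j}$ to $\mathcal F\otimes\mathcal F$ (an empty product is the identity). For $s\in\mathbb R$ let $T_0(s)$ be the second quantization of $e^{isP_1}$ on $\mathcal F$. *Bosonic 1+1 particle space.* Let $H^1=L^2(\mathbb R_+,p\,dp)$ be the one-particle space of the $U(1)$-current. The space $H^1\otimes H^1=L^2(\mathbb R_+^2,\,p\,dp\,\bar p\,d\bar p)$ is embedded isometrically in $\mathcal F\otimes\mathcal F$ by the map $\iota$ for which the only nonzero component of $\iota(\Psi)$ is the one with one $+$ fermion (momentum $p$) and one $-$ fermion (momentum $q$) in the left factor, and likewise $(\bar p,\bar q)$ in the right factor, namely $$\iota(\Psi)(p,q;\bar p,\bar q)=\frac1{(2\pi)^2}\Psi(p+q,\bar p+\bar q).$$ Let $e$ be the orthogonal projection of $\mathcal F\otimes\mathcal F$ onto the range of $\iota$. The translations $T_0(s)\otimes T_0(t)$ leave this range invariant; let $P$ be the generator of translations on $H^1$, so that they act on $H^1\otimes H^1$ as $e^{is(P\otimes1)+it(1\otimes P)}$. **Proposition.** Define,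 for $p\in\mathbb R\setminus\{0\}$, $$\tilde\varphi(p)=\frac1p\int_0^p\int_0^1\varphi\big((p-x)(1-y)\big)\,\varphi(xy)\,\check\varphi\big((p-x)y\big)\,\check\varphi\big(x(1-y)\big)\,dy\,dx ,$$ and $\tilde\varphi(0)=0$ (an immaterial convention). Then: 1. $eS_\varphi e=\tilde\varphi(P\otimes P)$; precisely, there is a bounded operator $T$ on $H^1\otimes H^1$ that is the functional calculus $T=\tilde\varphi(P\otimes P)=\int\tilde\varphi(\lambda\mu)\,dE(\lambda,\mu)$, where $E$ is the joint spectral measure of $P\otimes1$ and $1\otimes P$, and $eS_\varphi e=\iota\,T\,\iota^*$ on $\mathcal F\otimes\mathcal F$. 2. $\tilde\varphi$ is the boundary value of an analytic function on the upper half-plane that is bounded by $1$: there is an analytic $F:\mathbb H\to\mathbb C$ with $|F|\le1$ on $\mathbb H$ and $\lim_{y\downarrow0}F(p+iy)=\tilde\varphi(p)$ for every real $p\ne0$. 3. $|\tilde\varphi(p)|\le1$ for all $p\in\mathbb R$. -/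

import Mathlib

open MeasureTheory Filter Topology
open scoped ENNReal

namespace FermiScattering

noncomputable section

/-! ### Inner functions and the function `φ̃` -/

/-- The open upper half-plane, as a subset of `ℂ`. -/
def upperHalf : Set ℂ := {z | 0 < z.im}

/-- `φ : ℝ → ℂ` is an inner function (not necessarily symmetric): it is the almost everywhere
boundary value of a bounded analytic function on the upper half-plane, and it has modulus `1`
almost everywhere. -/
structure IsInner (φ : ℝ → ℂ) : Prop where
  exists_extension : ∃ Φ : ℂ → ℂ, DifferentiableOn ℂ Φ upperHalf ∧
    (∃ C : ℝ, ∀ z ∈ upperHalf, ‖Φ z‖ ≤ C) ∧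
    ∀ᵐ x : ℝ, Tendsto (fun y : ℝ => Φ (x + y * Complex.I)) (𝓝[>] 0) (𝓝 (φ x))
  norm_eq_one : ∀ᵐ x : ℝ, ‖φ x‖ = 1

/-- `φ̌(p) = conj (φ(-p))`. -/
def check (φ : ℝ → ℂ) (p : ℝ) : ℂ := (starRingEnd ℂ) (φ (-p))

/-- `φ̃(p) = p⁻¹ ∫₀ᵖ ∫₀¹ φ((p-x)(1-y)) φ(xy) φ̌((p-x)y) φ̌(x(1-y)) dy dx`. -/
def phiTilde (φ : ℝ → ℂ) (p : ℝ) : ℂ :=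
  (p : ℂ)⁻¹ * ∫ x in (0 : ℝ)..p, ∫ y in (0 : ℝ)..1,
    φ ((p - x) * (1 - y)) * φ (x * y) * check φ ((p - x) * y) * check φ (x * (1 - y))

/-! ### Multiplication operators -/

/-- Multiplication by the essentially bounded function `g` on `L²(μ)`. -/
def mulOp {α : Type*} [MeasurableSpace α] {μ : Measure α} (g : α → ℂ) (hg : MemLp g ∞ μ) :
    Lp ℂ 2 μ →L[ℂ] Lp ℂ 2 μ :=
  (ContinuousLinearMap.mul ℂ ℂ).holderL μ ∞ 2 2 (hg.toLp g)

theorem coeFn_mulOp {α : Type*} [MeasurableSpace α] {μ : Measure α} (g : α → ℂ)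
    (hg : MemLp g ∞ μ) (f : Lp ℂ 2 μ) : mulOp g hg f =ᵐ[μ] fun a => g a * f a := by
  have h := (ContinuousLinearMap.mul ℂ ℂ).coeFn_holder (r := 2) (hg.toLp g) f
  have h2 := hg.coeFn_toLp
  rw [mulOp, ContinuousLinearMap.holderL_apply_apply]
  filter_upwards [h, h2] with a ha hb
  rw [ha, hb]; rfl

/-! ### The Fock space of the complex fermion, in momentum space -/

/-- A point of `ℝ₊ × {+,-}`: momentum and charge (`true` is `+`, `false` is `-`). -/
abbrev Mode : Type := ℝ × Bool

/-- The measure `2π dp` on `ℝ₊`, on each of the two copies; `L²` of it is the fermionic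
one-particle space `H¹ = H₊ ⊕ H₋`. -/
def modeMeasure : Measure Mode :=
  (ENNReal.ofReal (2 * Real.pi) • volume.restrict (Set.Ioi (0 : ℝ))).prod Measure.count

instance : SigmaFinite (ENNReal.ofReal (2 * Real.pi) • volume.restrict (Set.Ioi (0 : ℝ))) :=
  SMul.sigmaFinite (2 * Real.pi).toNNReal

instance : SigmaFinite modeMeasure := by unfold modeMeasure; infer_instance

/-- `m` modes for the left tensor factor and `n` modes for the right one, `m, n = 0, 1, 2, …`. -/
abbrev Config : Type := Σ k : ℕ × ℕ, (Fin k.1 → Mode) × (Fin k.2 → Mode)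

def sectorMeasure (k : ℕ × ℕ) : Measure ((Fin k.1 → Mode) × (Fin k.2 → Mode)) :=
  (Measure.pi fun _ => modeMeasure).prod (Measure.pi fun _ => modeMeasure)

/-- The sum of the product measures on the sectors. -/
def configMeasure : Measure Config :=
  Measure.sum fun k => (sectorMeasure k).map (Sigma.mk k)

/-- The tensor product of two unsymmetrized Fock spaces,
`⨁ₘₙ (H¹)^{⊗m} ⊗ (H¹)^{⊗n} = ⨁ₘₙ L²((ℝ₊ × {±})^m × (ℝ₊ × {±})^n)`, realized as `L²` of the
disjoint union of the sectors. -/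
abbrev UFock : Type := Lp ℂ 2 configMeasure

/-- Permutation of the variables of the two tensor factors, in each sector. -/
def permute (σ τ : ∀ n : ℕ, Equiv.Perm (Fin n)) (z : Config) : Config :=
  ⟨z.1, z.2.1 ∘ σ z.1.1, z.2.2 ∘ τ z.1.2⟩

def permSign (σ τ : ∀ n : ℕ, Equiv.Perm (Fin n)) (z : Config) : ℂ :=
  ((Equiv.Perm.sign (σ z.1.1) : ℤ) : ℂ) * ((Equiv.Perm.sign (τ z.1.2) : ℤ) : ℂ)

theorem measurableSet_config {s : Set Config}
    (h : ∀ k, MeasurableSet {x : (Fin k.1 → Mode) × (Fin k.2 → Mode) | (⟨k, x⟩ : Config) ∈ s}) :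
    MeasurableSet s := by
  rw [MeasurableSpace.measurableSet_iInf]
  exact h

theorem measurable_config {β : Type*} [MeasurableSpace β] {f : Config → β}
    (h : ∀ k, Measurable fun x => f ⟨k, x⟩) : Measurable f := by
  intro s hs
  rw [MeasurableSpace.measurableSet_iInf]
  intro k
  exact h k hs

theorem measurable_sigmaMk (k : ℕ × ℕ) :
    Measurable (fun x : (Fin k.1 → Mode) × (Fin k.2 → Mode) => (⟨k, x⟩ : Config)) := by
  intro s hs
  exact (MeasurableSpace.measurableSet_iInf.1 hs) k

theorem lintegral_config {f : Config → ℝ≥0∞} (hf : Measurable f) :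
    ∫⁻ z, f z ∂configMeasure = ∑' k, ∫⁻ x, f ⟨k, x⟩ ∂sectorMeasure k := by
  rw [configMeasure, lintegral_sum_measure]
  congr 1; ext k
  rw [lintegral_map hf (measurable_sigmaMk k)]

theorem ae_config {p : Config → Prop} (h : ∀ k, ∀ᵐ x ∂sectorMeasure k, p ⟨k, x⟩) :
    ∀ᵐ z ∂configMeasure, p z := by
  rw [configMeasure, Measure.ae_sum_iff]
  intro k
  obtain ⟨s, hs, hsm, h0⟩ := exists_measurable_superset_of_null (ae_iff.1 (h k))
  rw [ae_iff]
  refine measure_mono_null (t := Sigma.mk k '' s ∪ {z | z.1 ≠ k}) ?_ ?_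
  · rintro ⟨k', x⟩ hz
    by_cases hk : k' = k
    · subst hk; exact Or.inl ⟨x, hs hz, rfl⟩
    · exact Or.inr hk
  · rw [Measure.map_apply (measurable_sigmaMk k)]
    · refine measure_mono_null (t := s) ?_ h0
      rintro x (⟨y, hy, e⟩ | hx)
      · cases e; exact hy
      · exact absurd rfl hx
    · refine measurableSet_config fun k' => ?_
      by_cases hk : k' = k
      · subst hk
        convert hsm using 1
        ext x; simp
      · convert MeasurableSet.univ using 1
        ext x; simp [hk]

theorem measurePreserving_perm {n : ℕ} (σ : Equiv.Perm (Fin n)) :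
    MeasurePreserving (fun x : Fin n → Mode => x ∘ σ)
      (Measure.pi fun _ => modeMeasure) (Measure.pi fun _ => modeMeasure) := by
  have h := measurePreserving_piCongrLeft (α := fun _ : Fin n => Mode)
    (fun _ => modeMeasure) σ.symm
  convert h using 1
  ext x i
  · simp [MeasurableEquiv.piCongrLeft, Equiv.piCongrLeft, Equiv.piCongrLeft']
  · simp [MeasurableEquiv.piCongrLeft, Equiv.piCongrLeft, Equiv.piCongrLeft']

theorem measurePreserving_permute (σ τ : ∀ n : ℕ, Equiv.Perm (Fin n)) :
    MeasurePreserving (permute σ τ) configMeasure configMeasure := by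
  have hm : Measurable (permute σ τ) := by
    refine measurable_config fun k => (measurable_sigmaMk k).comp ?_
    exact ((measurePreserving_perm (σ k.1)).measurable.comp measurable_fst).prodMk
      ((measurePreserving_perm (τ k.2)).measurable.comp measurable_snd)
  refine ⟨hm, ?_⟩
  rw [configMeasure, Measure.map_sum hm.aemeasurable]
  congr 1; ext1 k
  rw [Measure.map_map hm (measurable_sigmaMk k)]
  have h := (measurePreserving_perm (σ k.1)).prod (measurePreserving_perm (τ k.2))
  have h2 := h.map_eq
  conv_rhs => rw [sectorMeasure, ← h2]
  rw [Measure.map_map (measurable_sigmaMk k) h.measurable]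
  rfl

theorem memLp_permSign (σ τ : ∀ n : ℕ, Equiv.Perm (Fin n)) :
    MemLp (permSign σ τ) ∞ configMeasure := by
  refine memLp_top_of_bound (measurable_config fun k => ?_).aestronglyMeasurable 1
    (Eventually.of_forall fun z => ?_)
  · exact (measurable_const : Measurable fun _ : (Fin k.1 → Mode) × (Fin k.2 → Mode) =>
      ((Equiv.Perm.sign (σ k.1) : ℤ) : ℂ) * ((Equiv.Perm.sign (τ k.2) : ℤ) : ℂ))
  · rcases Int.units_eq_one_or (Equiv.Perm.sign (σ z.1.1)) with h | h <;>
      rcases Int.units_eq_one_or (Equiv.Perm.sign (τ z.1.2)) with h' | h' <;>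
      simp [permSign, h, h']

/-- `F ↦ F ∘ permute σ τ`. -/
def permOp (σ τ : ∀ n : ℕ, Equiv.Perm (Fin n)) : UFock →L[ℂ] UFock :=
  (Lp.compMeasurePreservingₗᵢ ℂ (permute σ τ)
    (measurePreserving_permute σ τ)).toContinuousLinearMap

/-- The tensor product of two antisymmetric (fermionic) Fock spaces: the functions that are
antisymmetric in the variables of the left factor and in those of the right factor. -/
def fermiFock : Submodule ℂ UFock where
  carrier := {F | ∀ σ τ, permOp σ τ F = mulOp (permSign σ τ) (memLp_permSign σ τ) F}
  add_mem' := by intro F G hF hG σ τ; rw [map_add, map_add, hF, hG]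
  zero_mem' := by intro σ τ; rw [map_zero, map_zero]
  smul_mem' := by intro c F hF σ τ; rw [map_smul, map_smul, hF]

abbrev FermiFock : Type := fermiFock

instance : CompleteSpace FermiFock := by
  have : IsClosed (fermiFock : Set UFock) := by
    have : (fermiFock : Set UFock) = ⋂ σ, ⋂ τ,
        {F | permOp σ τ F = mulOp (permSign σ τ) (memLp_permSign σ τ) F} := by
      ext F; simp only [Set.mem_iInter]; rfl
    rw [this]
    exact isClosed_iInter fun σ => isClosed_iInter fun τ =>
      isClosed_eq (ContinuousLinearMap.continuous _) (ContinuousLinearMap.continuous _)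
  exact this.completeSpace_coe

theorem mulOp_mem_fermiFock (g : Config → ℂ) (hg : MemLp g ∞ configMeasure)
    (hs : ∀ σ τ z, g (permute σ τ z) = g z) (F : UFock) (hF : F ∈ fermiFock) :
    mulOp g hg F ∈ fermiFock := by
  intro σ τ
  have hq := (measurePreserving_permute σ τ).quasiMeasurePreserving
  have e1 : ∀ G : UFock, permOp σ τ G =ᵐ[configMeasure] fun z => G (permute σ τ z) :=
    fun G => Lp.coeFn_compMeasurePreserving G (measurePreserving_permute σ τ)
  apply Lp.ext
  filter_upwards [e1 (mulOp g hg F), hq.ae (coeFn_mulOp g hg F), e1 F, coeFn_mulOp g hg F,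
    coeFn_mulOp _ (memLp_permSign σ τ) F, coeFn_mulOp _ (memLp_permSign σ τ) (mulOp g hg F)]
    with z h1 h2 h3 h4 h5 h6
  rw [h1, h2, h6, h4, hs, ← h3, hF σ τ, h5]; ring

/-- Multiplication by a bounded permutation invariant function on the fermionic space. -/
def fermiMul (g : Config → ℂ) (hg : MemLp g ∞ configMeasure)
    (hs : ∀ σ τ z, g (permute σ τ z) = g z) : FermiFock →L[ℂ] FermiFock :=
  ((mulOp g hg).comp fermiFock.subtypeL).codRestrict fermiFock
    fun F => mulOp_mem_fermiFock g hg hs F F.2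

/-! ### The operator `S_φ` -/

/-- The function by which
`M_φ = φ(P₊⊗P₊) ⊕ φ̌(P₊⊗P₋) ⊕ φ̌(P₋⊗P₊) ⊕ φ(P₋⊗P₋)` multiplies on `H¹ ⊗ H¹`. -/
def pairSymbol (φ : ℝ → ℂ) (a b : Mode) : ℂ :=
  if a.2 = b.2 then φ (a.1 * b.1) else check φ (a.1 * b.1)

/-- The function by which `S_φ = ⨁ₘₙ ∏ᵢⱼ (M_φ)ᵢⱼ` multiplies, `(M_φ)ᵢⱼ` being `M_φ` acting on
the `i`-th variable of the left and the `j`-th variable of the right factor. -/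
def scatteringSymbol (φ : ℝ → ℂ) (z : Config) : ℂ :=
  ∏ i, ∏ j, pairSymbol φ (z.2.1 i) (z.2.2 j)

theorem scatteringSymbol_permute (φ : ℝ → ℂ) (σ τ : ∀ n : ℕ, Equiv.Perm (Fin n)) (z : Config) :
    scatteringSymbol φ (permute σ τ z) = scatteringSymbol φ z := by
  obtain ⟨k, x, y⟩ := z
  change ∏ i : Fin k.1, ∏ j : Fin k.2, pairSymbol φ (x (σ k.1 i)) (y (τ k.2 j)) =
    ∏ i : Fin k.1, ∏ j : Fin k.2, pairSymbol φ (x i) (y j)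
  rw [Equiv.prod_comp (σ k.1) (fun i => ∏ j, pairSymbol φ (x i) (y (τ k.2 j)))]
  exact Finset.prod_congr rfl fun i _ =>
    Equiv.prod_comp (τ k.2) (fun j => pairSymbol φ (x i) (y j))

theorem IsInner.aemeasurable {φ : ℝ → ℂ} (h : IsInner φ) : AEMeasurable φ := by
  obtain ⟨Φ, hd, -, hb⟩ := h.exists_extension
  have hu : Tendsto (fun n : ℕ => (1 : ℝ) / ((n : ℝ) + 1)) atTop (𝓝[>] 0) :=
    tendsto_nhdsWithin_iff.2 ⟨tendsto_one_div_add_atTop_nhds_zero_nat,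
      Eventually.of_forall fun n => by simp only [Set.mem_Ioi]; positivity⟩
  refine aemeasurable_of_tendsto_metrizable_ae' (f := fun (n : ℕ) (x : ℝ) =>
    Φ (x + ((1 / ((n : ℝ) + 1) : ℝ) : ℂ) * Complex.I)) (fun n => ?_) ?_
  · refine Continuous.aemeasurable (continuous_iff_continuousAt.2 fun x => ?_)
    have hz : ((x : ℂ) + ((1 / ((n : ℝ) + 1) : ℝ) : ℂ) * Complex.I) ∈ upperHalf := by
      simp only [upperHalf, Set.mem_ofPred_eq, Complex.add_im, Complex.ofReal_im,
        Complex.im_ofReal_mul, Complex.I_im, zero_add, mul_one]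
      positivity
    have ho : IsOpen upperHalf := isOpen_lt continuous_const Complex.continuous_im
    have h1 := ((hd _ hz).differentiableAt (ho.mem_nhds hz)).continuousAt
    exact ContinuousAt.comp (f := fun x : ℝ =>
      ((x : ℂ) + ((1 / ((n : ℝ) + 1) : ℝ) : ℂ) * Complex.I)) h1 (by fun_prop)
  · filter_upwards [hb] with x hx
    exact hx.comp hu

/-- A property of almost every real number holds at the products of momenta. -/
theorem ae_config_mul {q : ℝ → Prop} (h : ∀ᵐ t : ℝ, q t) :
    ∀ᵐ z ∂configMeasure, ∀ i j, q ((z.2.1 i).1 * (z.2.2 j).1) := by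
  have h1 : ∀ᵐ w ∂(modeMeasure.prod modeMeasure), q (w.1.1 * w.2.1) := by
    obtain ⟨s, hs, hsm, h0⟩ := exists_measurable_superset_of_null (ae_iff.1 h)
    have key : ∀ᵐ w ∂(modeMeasure.prod modeMeasure), w.1.1 * w.2.1 ∉ s := by
      have hms : MeasurableSet {w : Mode × Mode | w.1.1 * w.2.1 ∉ s} :=
        (show Measurable fun w : Mode × Mode => w.1.1 * w.2.1 by fun_prop) hsm.compl
      rw [Measure.ae_prod_iff_ae_ae hms]
      have hpos : ∀ᵐ a ∂modeMeasure, 0 < a.1 := by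
        have : ∀ᵐ p ∂(ENNReal.ofReal (2 * Real.pi) • volume.restrict (Set.Ioi (0 : ℝ))), 0 < p :=
          Measure.ae_smul_measure (ae_restrict_mem measurableSet_Ioi) _
        exact Measure.quasiMeasurePreserving_fst.ae this
      filter_upwards [hpos] with a ha
      have hs0 : ∀ᵐ t : ℝ, t ∉ s := by rw [ae_iff]; simpa using h0
      have h3 : ∀ᵐ t : ℝ, a.1 * t ∉ s := by
        rw [ae_iff]
        have : {t : ℝ | ¬ a.1 * t ∉ s} = (fun t => a.1 * t) ⁻¹' s := by ext t; simp
        rw [this, Real.volume_preimage_mul_left ha.ne', h0, mul_zero]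
      have h4 : ∀ᵐ t ∂(ENNReal.ofReal (2 * Real.pi) • volume.restrict (Set.Ioi (0 : ℝ))),
          a.1 * t ∉ s := Measure.ae_smul_measure (ae_restrict_of_ae h3) _
      exact Measure.quasiMeasurePreserving_fst.ae h4
    filter_upwards [key] with w hw
    by_contra hc
    exact hw (hs hc)
  refine ae_config fun k => ?_
  refine ae_all_iff.2 fun (i : Fin k.1) => ae_all_iff.2 fun (j : Fin k.2) => ?_
  have hq : Measure.QuasiMeasurePreserving
      (Prod.map (Function.eval i) (Function.eval j) :
        (Fin k.1 → Mode) × (Fin k.2 → Mode) → Mode × Mode)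
      (sectorMeasure k) (modeMeasure.prod modeMeasure) :=
    QuasiMeasurePreserving.prodMap
      (Measure.quasiMeasurePreserving_eval (fun _ => modeMeasure) i)
      (Measure.quasiMeasurePreserving_eval (fun _ => modeMeasure) j)
  exact hq.ae h1

theorem memLp_scatteringSymbol {φ : ℝ → ℂ} (h : IsInner φ) :
    MemLp (scatteringSymbol φ) ∞ configMeasure := by
  have hneg : ∀ {q : ℝ → Prop}, (∀ᵐ t : ℝ, q t) → ∀ᵐ t : ℝ, q (-t) := fun hq =>
    (Measure.measurePreserving_neg volume).quasiMeasurePreserving.ae hq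
  obtain ⟨φ₀, hm, he⟩ := h.aemeasurable
  have hae : scatteringSymbol φ =ᵐ[configMeasure] scatteringSymbol φ₀ := by
    filter_upwards [ae_config_mul he, ae_config_mul (hneg he)] with z h1 h2
    refine Finset.prod_congr rfl fun i _ => Finset.prod_congr rfl fun j _ => ?_
    simp only [pairSymbol, check, h1 i j, h2 i j]
  have hmeas : Measurable (scatteringSymbol φ₀) := by
    refine measurable_config fun k => ?_
    change Measurable fun x : (Fin k.1 → Mode) × (Fin k.2 → Mode) =>
      ∏ i : Fin k.1, ∏ j : Fin k.2, pairSymbol φ₀ (x.1 i) (x.2 j)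
    refine Finset.measurable_fun_prod _ fun i _ => Finset.measurable_fun_prod _ fun j _ => ?_
    have hp : Measurable fun w : Mode × Mode => pairSymbol φ₀ w.1 w.2 := by
      unfold pairSymbol check
      refine Measurable.ite ?_ ?_ ?_
      · exact measurableSet_eq_fun (by fun_prop) (by fun_prop)
      · exact hm.comp (by fun_prop)
      · exact Complex.continuous_conj.measurable.comp (hm.comp (by fun_prop))
    exact hp.comp (f := fun x : (Fin k.1 → Mode) × (Fin k.2 → Mode) => (x.1 i, x.2 j))
      (by fun_prop)
  refine memLp_top_of_bound ⟨_, hmeas.stronglyMeasurable, hae⟩ 1 ?_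
  filter_upwards [ae_config_mul h.norm_eq_one, ae_config_mul (hneg h.norm_eq_one)] with z h1 h2
  refine le_of_eq ?_
  simp only [scatteringSymbol, norm_prod]
  refine Finset.prod_eq_one fun i _ => Finset.prod_eq_one fun j _ => ?_
  unfold pairSymbol check
  split_ifs
  · exact h1 i j
  · rw [RCLike.norm_conj]; exact h2 i j

/-- The scattering operator `S_φ` on the tensor product of two fermionic Fock spaces. -/
def scatteringOp (φ : ℝ → ℂ) (h : IsInner φ) : FermiFock →L[ℂ] FermiFock :=
  fermiMul (scatteringSymbol φ) (memLp_scatteringSymbol h) (scatteringSymbol_permute φ)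

/-! ### Translations -/

def translationPhase (s t : ℝ) (z : Config) : ℂ :=
  Complex.exp (Complex.I * ((s * ∑ i, (z.2.1 i).1 + t * ∑ j, (z.2.2 j).1 : ℝ) : ℂ))

theorem memLp_translationPhase (s t : ℝ) : MemLp (translationPhase s t) ∞ configMeasure := by
  refine memLp_top_of_bound (measurable_config fun k => ?_).aestronglyMeasurable 1
    (Eventually.of_forall fun z => ?_)
  · change Measurable fun x : (Fin k.1 → Mode) × (Fin k.2 → Mode) => Complex.exp (Complex.I *
      ((s * ∑ i : Fin k.1, (x.1 i).1 + t * ∑ j : Fin k.2, (x.2 j).1 : ℝ) : ℂ))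
    have h1 : Measurable fun x : (Fin k.1 → Mode) × (Fin k.2 → Mode) =>
        ∑ i : Fin k.1, (x.1 i).1 :=
      Finset.measurable_fun_sum _ fun i _ => by fun_prop
    have h2 : Measurable fun x : (Fin k.1 → Mode) × (Fin k.2 → Mode) =>
        ∑ j : Fin k.2, (x.2 j).1 :=
      Finset.measurable_fun_sum _ fun j _ => by fun_prop
    fun_prop
  · rw [translationPhase, mul_comm, Complex.norm_exp_ofReal_mul_I]

theorem translationPhase_permute (s t : ℝ) (σ τ : ∀ n : ℕ, Equiv.Perm (Fin n)) (z : Config) :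
    translationPhase s t (permute σ τ z) = translationPhase s t z := by
  obtain ⟨k, x, y⟩ := z
  change Complex.exp (Complex.I * ((s * ∑ i : Fin k.1, (x (σ k.1 i)).1 +
      t * ∑ j : Fin k.2, (y (τ k.2 j)).1 : ℝ) : ℂ)) =
    Complex.exp (Complex.I * ((s * ∑ i : Fin k.1, (x i).1 + t * ∑ j : Fin k.2, (y j).1 : ℝ) : ℂ))
  rw [Equiv.sum_comp (σ k.1) (fun i => (x i).1), Equiv.sum_comp (τ k.2) (fun j => (y j).1)]

/-- The translations `T₀(s) ⊗ T₀(t)`, where `T₀(s)` is the second quantization of `e^{isP₁}` and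
`P₁ = P₊ ⊕ P₋` is the one-particle momentum. -/
def translation (s t : ℝ) : FermiFock →L[ℂ] FermiFock :=
  fermiMul (translationPhase s t) (memLp_translationPhase s t) (translationPhase_permute s t)

/-! ### The bosonic 1+1 particle space -/

/-- The measure `p dp` on `ℝ₊`; `L²` of it is the one-particle space of the `U(1)`-current. -/
def boseMeasure : Measure ℝ :=
  (volume.restrict (Set.Ioi (0 : ℝ))).withDensity fun p => ENNReal.ofReal p

instance : SigmaFinite boseMeasure := by
  unfold boseMeasure
  exact SigmaFinite.withDensity_of_ne_top (Eventually.of_forall fun _ => ENNReal.ofReal_ne_top)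

/-- The space `H¹ ⊗ H¹ = L²(ℝ₊, p dp) ⊗ L²(ℝ₊, p̄ dp̄)`. -/
abbrev BosePair : Type := Lp ℂ 2 (boseMeasure.prod boseMeasure)

/-- A function `f(p, q)` of the momenta of a `+` and a `-` fermion is the antisymmetric function
of two modes that equals `f(p, q)/√2` at `((p,+), (q,-))`, `-f(p, q)/√2` at `((q,-), (p,+))`
and `0` at modes of equal charge. -/
def chargeCoeff (x : Fin 2 → Mode) : ℂ :=
  if (x 0).2 = true ∧ (x 1).2 = false then ((1 / Real.sqrt 2 : ℝ) : ℂ)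
  else if (x 0).2 = false ∧ (x 1).2 = true then ((-(1 / Real.sqrt 2) : ℝ) : ℂ)
  else 0

/-- The wave function with only nonzero component
`(p, q, p̄, q̄) ↦ (2π)⁻² Ψ(p + q, p̄ + q̄)` in the sector of one `+` and one `-` fermion in each
of the two tensor factors. -/
def embedFun (Ψ : ℝ × ℝ → ℂ) : Config → ℂ
  | ⟨(2, 2), x⟩ => (((2 * Real.pi) ^ 2)⁻¹ : ℝ) * chargeCoeff x.1 * chargeCoeff x.2 *
      Ψ ((x.1 0).1 + (x.1 1).1, (x.2 0).1 + (x.2 1).1)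
  | _ => 0

theorem measurable_chargeCoeff : Measurable chargeCoeff := by
  unfold chargeCoeff
  refine Measurable.ite ?_ measurable_const (Measurable.ite ?_ measurable_const measurable_const)
  · exact (measurableSet_eq_fun (f := fun x : Fin 2 → Mode => (x 0).2) (by fun_prop)
      measurable_const).inter (measurableSet_eq_fun (f := fun x : Fin 2 → Mode => (x 1).2)
      (by fun_prop) measurable_const)
  · exact (measurableSet_eq_fun (f := fun x : Fin 2 → Mode => (x 0).2) (by fun_prop)
      measurable_const).inter (measurableSet_eq_fun (f := fun x : Fin 2 → Mode => (x 1).2)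
      (by fun_prop) measurable_const)

theorem lintegral_modeMeasure {g : Mode → ℝ≥0∞} (hg : Measurable g) :
    ∫⁻ a, g a ∂modeMeasure =
      ENNReal.ofReal (2 * Real.pi) * ∫⁻ p in Set.Ioi 0, (g (p, true) + g (p, false)) := by
  rw [modeMeasure, lintegral_prod _ hg.aemeasurable, lintegral_smul_measure, smul_eq_mul]
  congr 1
  refine lintegral_congr fun p => ?_
  rw [lintegral_count, tsum_fintype, Fintype.sum_bool]

theorem lintegral_add_momenta {h : ℝ → ℝ≥0∞} (hh : Measurable h) :
    ∫⁻ p in Set.Ioi (0 : ℝ), ∫⁻ q in Set.Ioi (0 : ℝ), h (p + q) = ∫⁻ s, h s ∂boseMeasure := by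
  have hi : Measurable fun w : ℝ × ℝ => (Set.Ioi w.1).indicator h w.2 := by
    have : (fun w : ℝ × ℝ => (Set.Ioi w.1).indicator h w.2) =
        Set.indicator {w : ℝ × ℝ | w.1 < w.2} (fun w => h w.2) := by
      ext w; simp [Set.indicator]
    rw [this]
    exact (hh.comp measurable_snd).indicator (measurableSet_lt measurable_fst measurable_snd)
  have h1 : ∀ p : ℝ, ∫⁻ q in Set.Ioi (0 : ℝ), h (p + q) =
      ∫⁻ s, (Set.Ioi p).indicator h s := by
    intro p
    rw [← lintegral_indicator measurableSet_Ioi,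
      ← lintegral_add_left_eq_self (fun s => (Set.Ioi p).indicator h s) p]
    refine lintegral_congr fun q => ?_
    simp [Set.indicator]
  simp_rw [h1]
  rw [lintegral_lintegral_swap (f := fun p s => (Set.Ioi p).indicator h s) hi.aemeasurable]
  rw [boseMeasure, lintegral_withDensity_eq_lintegral_mul _ (by fun_prop) hh,
    ← lintegral_indicator measurableSet_Ioi]
  refine lintegral_congr fun s => ?_
  have h2 : ∀ p : ℝ, (Set.Ioi p).indicator h s = (Set.Iio s).indicator (fun _ => h s) p := by
    intro p; simp [Set.indicator]
  simp_rw [h2]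
  rw [lintegral_indicator measurableSet_Iio, lintegral_const,
    Measure.restrict_restrict measurableSet_Iio, Measure.restrict_apply_univ, Set.Iio_inter_Ioi,
    Real.volume_Ioo, sub_zero]
  by_cases hs : 0 < s
  · simp [hs, mul_comm]
  · simp [hs, ENNReal.ofReal_of_nonpos (not_lt.1 hs)]

theorem lintegral_chargeCoeff {h : ℝ → ℝ≥0∞} (hh : Measurable h) :
    ∫⁻ x, ‖chargeCoeff x‖ₑ ^ 2 * h ((x 0).1 + (x 1).1) ∂(Measure.pi fun _ => modeMeasure) =
      ENNReal.ofReal (2 * Real.pi) ^ 2 * ∫⁻ s, h s ∂boseMeasure := by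
  have hm : Measurable fun w : Mode × Mode =>
      ‖chargeCoeff ![w.1, w.2]‖ₑ ^ 2 * h (w.1.1 + w.2.1) := by
    refine Measurable.mul ?_ (hh.comp (by fun_prop))
    refine Measurable.pow_const (Measurable.enorm (measurable_chargeCoeff.comp ?_)) 2
    refine measurable_pi_lambda _ fun i => ?_
    fin_cases i
    · exact measurable_fst
    · exact measurable_snd
  obtain ⟨G, hG⟩ : ∃ G : Mode × Mode → ℝ≥0∞, ∀ a b, G (a, b) =
      ‖chargeCoeff ![a, b]‖ₑ ^ 2 * h (a.1 + b.1) := 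
    ⟨fun w => ‖chargeCoeff ![w.1, w.2]‖ₑ ^ 2 * h (w.1.1 + w.2.1), fun _ _ => rfl⟩
  replace hm : Measurable G := by
    convert hm using 1
    ext w; exact hG w.1 w.2
  have h0 := (measurePreserving_finTwoArrow modeMeasure).lintegral_comp hm
  have e0 : ∀ x : Fin 2 → Mode, G (MeasurableEquiv.finTwoArrow x) =
      ‖chargeCoeff x‖ₑ ^ 2 * h ((x 0).1 + (x 1).1) := by
    intro x
    have e1 : ![x 0, x 1] = x := by ext i <;> fin_cases i <;> rfl
    have e2 := hG (x 0) (x 1)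
    rw [e1] at e2
    exact e2
  simp_rw [e0] at h0
  refine h0.trans ?_
  have half : ENNReal.ofReal ((1 / Real.sqrt 2) ^ 2) = 2⁻¹ := by
    rw [div_pow, Real.sq_sqrt (by norm_num), one_pow, one_div,
      ENNReal.ofReal_inv_of_pos (by norm_num)]
    simp
  have en : ∀ r : ℝ, ‖(r : ℂ)‖ₑ ^ 2 = ENNReal.ofReal (r ^ 2) := by
    intro r
    rw [← ofReal_norm, Complex.norm_real, ← ENNReal.ofReal_pow (norm_nonneg _),
      Real.norm_eq_abs, sq_abs]
  rw [lintegral_prod _ hm.aemeasurable, lintegral_modeMeasure (Measurable.lintegral_prod_right' hm)]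
  have hs : ∀ p : ℝ, ∀ c : Bool,
      ∫⁻ b, G ((p, c), b) ∂modeMeasure =
      ENNReal.ofReal (2 * Real.pi) * (2⁻¹ * ∫⁻ q in Set.Ioi (0 : ℝ), h (p + q)) := by
    intro p c
    have hmp : Measurable fun b : Mode => G ((p, c), b) := hm.comp (by fun_prop)
    rw [lintegral_modeMeasure hmp, ← lintegral_const_mul _
      (show Measurable fun q : ℝ => h (p + q) from hh.comp (measurable_const.add measurable_id))]
    congr 1
    refine lintegral_congr fun q => ?_
    rw [hG, hG]
    cases c
    · simp only [chargeCoeff, Matrix.cons_val_zero, Matrix.cons_val_one, Bool.false_eq_true,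
        false_and, if_false, true_and, if_true, en, neg_sq, half, and_false, enorm_zero]
      simp
    · simp only [chargeCoeff, Matrix.cons_val_zero, Matrix.cons_val_one, Bool.true_eq_false,
        false_and, if_false, true_and, if_true, en, half, enorm_zero]
      simp
  simp only [hs]
  have hmm : Measurable fun p : ℝ => ∫⁻ q in Set.Ioi (0 : ℝ), h (p + q) :=
    Measurable.lintegral_prod_right' (f := fun w : ℝ × ℝ => h (w.1 + w.2))
      (hh.comp (measurable_fst.add measurable_snd))
  have e2 : ∀ a b : ℝ≥0∞, a * (2⁻¹ * b) + a * (2⁻¹ * b) = a * b := by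
    intro a b
    rw [← mul_add, ← add_mul, ENNReal.inv_two_add_inv_two, one_mul]
  simp only [e2]
  rw [lintegral_const_mul _ hmm, lintegral_add_momenta hh, sq, mul_assoc]

theorem measurable_embedFun {Ψ : ℝ × ℝ → ℂ} (hΨ : Measurable Ψ) : Measurable (embedFun Ψ) := by
  refine measurable_config fun k => ?_
  by_cases hk : k = (2, 2)
  · subst hk
    change Measurable fun x : (Fin 2 → Mode) × (Fin 2 → Mode) =>
      ((((2 * Real.pi) ^ 2)⁻¹ : ℝ) : ℂ) * chargeCoeff x.1 * chargeCoeff x.2 *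
      Ψ ((x.1 0).1 + (x.1 1).1, (x.2 0).1 + (x.2 1).1)
    have h1 := measurable_chargeCoeff
    fun_prop
  · have : (fun x => embedFun Ψ ⟨k, x⟩) = fun _ => 0 := by
      ext x
      unfold embedFun
      split
      · rename_i h; cases h; exact absurd rfl hk
      · rfl
    rw [this]; exact measurable_const

theorem lintegral_embedFun {Ψ : ℝ × ℝ → ℂ} (hΨ : Measurable Ψ) :
    ∫⁻ z, ‖embedFun Ψ z‖ₑ ^ 2 ∂configMeasure =
      ∫⁻ w, ‖Ψ w‖ₑ ^ 2 ∂(boseMeasure.prod boseMeasure) := by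
  rw [lintegral_config ((measurable_embedFun hΨ).enorm.pow_const 2), tsum_eq_single (2, 2)]
  · set c : ℝ≥0∞ := ENNReal.ofReal (2 * Real.pi) with hc
    have hc0 : c ≠ 0 := by rw [hc]; simp [Real.pi_pos]
    have hct : c ≠ ∞ := ENNReal.ofReal_ne_top
    have hcc : ‖((((2 * Real.pi) ^ 2)⁻¹ : ℝ) : ℂ)‖ₑ = (c ^ 2)⁻¹ := by
      rw [← ofReal_norm, Complex.norm_real, Real.norm_eq_abs, abs_of_pos (by positivity),
        ENNReal.ofReal_inv_of_pos (by positivity), hc, ENNReal.ofReal_pow (by positivity)]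
    have e1 : ∀ x : (Fin 2 → Mode) × (Fin 2 → Mode), ‖embedFun Ψ ⟨(2, 2), x⟩‖ₑ ^ 2 =
        (c ^ 2)⁻¹ ^ 2 * (‖chargeCoeff x.1‖ₑ ^ 2 * (‖chargeCoeff x.2‖ₑ ^ 2 *
          ‖Ψ ((x.1 0).1 + (x.1 1).1, (x.2 0).1 + (x.2 1).1)‖ₑ ^ 2)) := by
      intro x
      rw [embedFun, enorm_mul, enorm_mul, enorm_mul, hcc]; ring
    have hcm := measurable_chargeCoeff
    have hN : Measurable fun w => ‖Ψ w‖ₑ ^ 2 := hΨ.enorm.pow_const 2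
    have hin : Measurable fun s : ℝ => ∫⁻ t, ‖Ψ (s, t)‖ₑ ^ 2 ∂boseMeasure :=
      Measurable.lintegral_prod_right' hN
    change ∫⁻ x : (Fin 2 → Mode) × (Fin 2 → Mode), ‖embedFun Ψ ⟨(2, 2), x⟩‖ₑ ^ 2
      ∂((Measure.pi fun _ => modeMeasure).prod (Measure.pi fun _ => modeMeasure)) = _
    simp_rw [e1]
    rw [lintegral_const_mul _ (by fun_prop), lintegral_prod _ (by fun_prop)]
    have e2 : ∀ x : Fin 2 → Mode, ∫⁻ y : Fin 2 → Mode, ‖chargeCoeff x‖ₑ ^ 2 *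
        (‖chargeCoeff y‖ₑ ^ 2 * ‖Ψ ((x 0).1 + (x 1).1, (y 0).1 + (y 1).1)‖ₑ ^ 2)
          ∂(Measure.pi fun _ => modeMeasure) =
        c ^ 2 * (‖chargeCoeff x‖ₑ ^ 2 *
          ∫⁻ t, ‖Ψ ((x 0).1 + (x 1).1, t)‖ₑ ^ 2 ∂boseMeasure) := by
      intro x
      rw [lintegral_const_mul _ (by fun_prop),
        lintegral_chargeCoeff (h := fun t => ‖Ψ ((x 0).1 + (x 1).1, t)‖ₑ ^ 2)
          (hN.comp (by fun_prop))]
      ring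
    simp only [e2]
    have hmo : Measurable fun x : Fin 2 → Mode => ‖chargeCoeff x‖ₑ ^ 2 *
        ∫⁻ t, ‖Ψ ((x 0).1 + (x 1).1, t)‖ₑ ^ 2 ∂boseMeasure :=
      (hcm.enorm.pow_const 2).mul (hin.comp (by fun_prop))
    rw [lintegral_const_mul _ hmo, lintegral_chargeCoeff hin, lintegral_prod _ hN.aemeasurable,
      ← mul_assoc, ← mul_assoc]
    have hone : (c ^ 2)⁻¹ ^ 2 * c ^ 2 * c ^ 2 = 1 := by
      rw [mul_assoc, ← sq, ← mul_pow, ENNReal.inv_mul_cancel (pow_ne_zero 2 hc0)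
        (ENNReal.pow_ne_top hct), one_pow]
    rw [hone, one_mul]
  · intro k hk
    have : ∀ x, embedFun Ψ ⟨k, x⟩ = 0 := by
      intro x
      unfold embedFun
      split
      · rename_i h; cases h; exact absurd rfl hk
      · rfl
    simp [this]

theorem eLpNorm_embedFun {Ψ : ℝ × ℝ → ℂ} (hΨ : Measurable Ψ) :
    eLpNorm (embedFun Ψ) 2 configMeasure = eLpNorm Ψ 2 (boseMeasure.prod boseMeasure) := by
  rw [eLpNorm_eq_lintegral_rpow_enorm_toReal two_ne_zero ENNReal.ofNat_ne_top,
    eLpNorm_eq_lintegral_rpow_enorm_toReal two_ne_zero ENNReal.ofNat_ne_top]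
  simp only [ENNReal.toReal_ofNat, ENNReal.rpow_ofNat]
  rw [lintegral_embedFun hΨ]

theorem memLp_embedFun (Ψ : BosePair) : MemLp (embedFun Ψ) 2 configMeasure := by
  have hm := (Lp.stronglyMeasurable Ψ).measurable
  refine ⟨(measurable_embedFun hm).aestronglyMeasurable, ?_⟩
  rw [eLpNorm_embedFun hm]
  exact Lp.eLpNorm_lt_top Ψ

theorem embedFun_sub (Ψ Φ : ℝ × ℝ → ℂ) (z : Config) :
    embedFun (Ψ - Φ) z = embedFun Ψ z - embedFun Φ z := by
  obtain ⟨k, x⟩ := z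
  by_cases hk : k = (2, 2)
  · subst hk; simp only [embedFun, Pi.sub_apply]; ring
  · unfold embedFun
    split
    · rename_i h; cases h; exact absurd rfl hk
    · simp

theorem embedFun_add (Ψ Φ : ℝ × ℝ → ℂ) (z : Config) :
    embedFun (Ψ + Φ) z = embedFun Ψ z + embedFun Φ z := by
  obtain ⟨k, x⟩ := z
  by_cases hk : k = (2, 2)
  · subst hk; simp only [embedFun, Pi.add_apply]; ring
  · unfold embedFun
    split
    · rename_i h; cases h; exact absurd rfl hk
    · simp

theorem embedFun_smul (c : ℂ) (Ψ : ℝ × ℝ → ℂ) (z : Config) :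
    embedFun (c • Ψ) z = c * embedFun Ψ z := by
  obtain ⟨k, x⟩ := z
  by_cases hk : k = (2, 2)
  · subst hk; simp only [embedFun, Pi.smul_apply, smul_eq_mul]; ring
  · unfold embedFun
    split
    · rename_i h; cases h; exact absurd rfl hk
    · simp

theorem embedFun_congr {Ψ Φ : ℝ × ℝ → ℂ} (hΨ : Measurable Ψ) (hΦ : Measurable Φ)
    (h : Ψ =ᵐ[boseMeasure.prod boseMeasure] Φ) : embedFun Ψ =ᵐ[configMeasure] embedFun Φ := by
  have h0 : eLpNorm (embedFun (Ψ - Φ)) 2 configMeasure = 0 := by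
    rw [eLpNorm_embedFun (hΨ.sub hΦ), eLpNorm_eq_zero_iff (hΨ.sub hΦ).aestronglyMeasurable
      two_ne_zero]
    filter_upwards [h] with w hw
    simp [hw]
  rw [eLpNorm_eq_zero_iff (measurable_embedFun (hΨ.sub hΦ)).aestronglyMeasurable
    two_ne_zero] at h0
  filter_upwards [h0] with z hz
  rw [embedFun_sub] at hz
  exact sub_eq_zero.1 hz

theorem chargeCoeff_perm (σ : Equiv.Perm (Fin 2)) (x : Fin 2 → Mode) :
    chargeCoeff (x ∘ σ) = ((Equiv.Perm.sign σ : ℤ) : ℂ) * chargeCoeff x ∧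
      ((x ∘ σ) 0).1 + ((x ∘ σ) 1).1 = (x 0).1 + (x 1).1 := by
  have hσ : σ = 1 ∨ σ = Equiv.swap 0 1 := by revert σ; decide
  rcases hσ with rfl | rfl
  · simp
  · refine ⟨?_, by simp [add_comm]⟩
    rw [Equiv.Perm.sign_swap (by decide)]
    cases h0 : (x 0).2 <;> cases h1 : (x 1).2 <;> simp [chargeCoeff, h0, h1]

theorem embedFun_permute (σ τ : ∀ n : ℕ, Equiv.Perm (Fin n)) (Ψ : ℝ × ℝ → ℂ) (z : Config) :
    embedFun Ψ (permute σ τ z) = permSign σ τ z * embedFun Ψ z := by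
  obtain ⟨k, x, y⟩ := z
  by_cases hk : k = (2, 2)
  · subst hk
    obtain ⟨h1, h2⟩ := chargeCoeff_perm (σ 2) x
    obtain ⟨h3, h4⟩ := chargeCoeff_perm (τ 2) y
    simp only [permute, embedFun, permSign]
    rw [h1, h2, h3, h4]; ring
  · have : ∀ w, embedFun Ψ ⟨k, w⟩ = 0 := by
      intro w
      unfold embedFun
      split
      · rename_i h; cases h; exact absurd rfl hk
      · rfl
    rw [this]
    exact (this _).trans (mul_zero _).symm

/-- The embedding of `H¹ ⊗ H¹` into the tensor product of the two fermionic Fock spaces, as an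
isometry: `Ψ` is mapped to the class of `embedFun Ψ`. -/
def embed : BosePair →ₗᵢ[ℂ] FermiFock where
  toFun Ψ := ⟨(memLp_embedFun Ψ).toLp _, by
    intro σ τ
    have e1 : permOp σ τ ((memLp_embedFun Ψ).toLp _) =ᵐ[configMeasure]
        fun z => (memLp_embedFun Ψ).toLp _ (permute σ τ z) :=
      Lp.coeFn_compMeasurePreserving _ (measurePreserving_permute σ τ)
    have hq := (measurePreserving_permute σ τ).quasiMeasurePreserving
    apply Lp.ext
    filter_upwards [e1, hq.ae (memLp_embedFun Ψ).coeFn_toLp, (memLp_embedFun Ψ).coeFn_toLp,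
      coeFn_mulOp _ (memLp_permSign σ τ) ((memLp_embedFun Ψ).toLp _)] with z h1 h2 h3 h4
    rw [h1, h2, h4, h3, embedFun_permute]⟩
  map_add' Ψ Φ := by
    refine Subtype.ext ?_
    change (memLp_embedFun (Ψ + Φ)).toLp _ =
      (memLp_embedFun Ψ).toLp _ + (memLp_embedFun Φ).toLp _
    rw [← MemLp.toLp_add]
    refine MemLp.toLp_congr _ _ ?_
    filter_upwards [embedFun_congr (Lp.stronglyMeasurable (Ψ + Φ)).measurable
      ((Lp.stronglyMeasurable Ψ).add (Lp.stronglyMeasurable Φ)).measurable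
      (Lp.coeFn_add Ψ Φ)] with z hz
    rw [hz, embedFun_add]; rfl
  map_smul' c Ψ := by
    refine Subtype.ext ?_
    change (memLp_embedFun (c • Ψ)).toLp _ = c • (memLp_embedFun Ψ).toLp _
    rw [← MemLp.toLp_const_smul]
    refine MemLp.toLp_congr _ _ ?_
    filter_upwards [embedFun_congr (Lp.stronglyMeasurable (c • Ψ)).measurable
      ((Lp.stronglyMeasurable Ψ).const_smul c).measurable (Lp.coeFn_smul c Ψ)] with z hz
    rw [hz, embedFun_smul]; rfl
  norm_map' Ψ := by
    change ‖(memLp_embedFun Ψ).toLp _‖ = ‖Ψ‖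
    rw [Lp.norm_toLp, eLpNorm_embedFun (Lp.stronglyMeasurable Ψ).measurable, Lp.norm_def]

/-- The closed subspace `H¹ ⊗ H¹` of the tensor product of the two fermionic Fock spaces. -/
def bosePairs : Submodule ℂ FermiFock := LinearMap.range embed.toLinearMap

instance : CompleteSpace bosePairs := by
  have : IsClosed (bosePairs : Set FermiFock) := by
    have h : (bosePairs : Set FermiFock) = Set.range embed := by
      ext F; rfl
    rw [h]
    exact embed.isometry.isClosedEmbedding.isClosed_range
  exact this.completeSpace_coe

/-- The orthogonal projection `e` onto `H¹ ⊗ H¹`. -/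
def boseProj : FermiFock →L[ℂ] FermiFock := bosePairs.starProjection

/-! ### Spectral measures and functional calculus -/

/-- A projection-valued measure on `X`, acting on the Hilbert space `H`. The values on
non-measurable sets are irrelevant. -/
structure SpectralMeasure (X : Type*) [MeasurableSpace X] (H : Type*) [NormedAddCommGroup H]
    [InnerProductSpace ℂ H] [CompleteSpace H] where
  proj : Set X → H →L[ℂ] H
  isStarProjection : ∀ s, MeasurableSet s → IsStarProjection (proj s)
  proj_univ : proj Set.univ = 1
  hasSum : ∀ s : ℕ → Set X, (∀ n, MeasurableSet (s n)) → Pairwise (Function.onFun Disjoint s) →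
    ∀ x, HasSum (fun n => proj (s n) x) (proj (⋃ n, s n) x)

namespace SpectralMeasure

variable {X Y : Type*} [MeasurableSpace X] [MeasurableSpace Y] {H : Type*}
  [NormedAddCommGroup H] [InnerProductSpace ℂ H] [CompleteSpace H]

theorem norm_sq_proj (E : SpectralMeasure X H) {s : Set X} (hs : MeasurableSet s) (x : H) :
    ‖E.proj s x‖ ^ 2 = (inner ℂ x (E.proj s x)).re := by
  have h := E.isStarProjection s hs
  have h1 : E.proj s (E.proj s x) = E.proj s x :=
    congrArg (fun T : H →L[ℂ] H => T x) h.isIdempotentElem.eq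
  have h2 := h.isSelfAdjoint.adjoint_eq
  have h3 : inner ℂ x (E.proj s x) = inner ℂ (E.proj s x) (E.proj s x) := by
    conv_lhs => rw [← h1]
    rw [← ContinuousLinearMap.adjoint_inner_left, h2]
  rw [h3]
  exact (inner_self_eq_norm_sq (𝕜 := ℂ) (E.proj s x)).symm

/-- The finite measure `s ↦ ‖E(s) x‖² = ⟪x, E(s) x⟫`. -/
def measure (E : SpectralMeasure X H) (x : H) : Measure X :=
  Measure.ofMeasurable (fun s _ => ENNReal.ofReal (‖E.proj s x‖ ^ 2))
    (by
      have h := E.hasSum (fun _ => ∅) (fun _ => MeasurableSet.empty)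
        (fun _ _ _ => disjoint_bot_left) x
      have h0 : E.proj ∅ x = 0 := by
        have := h.summable.tendsto_atTop_zero
        exact tendsto_nhds_unique tendsto_const_nhds this
      simp [h0])
    (by
      intro s hs hd
      have h := (E.hasSum s hs hd x).mapL (innerSL ℂ x)
      have h2 := Complex.hasSum_re h
      simp only [innerSL_apply_apply] at h2
      have h3 : HasSum (fun n => ‖E.proj (s n) x‖ ^ 2) (‖E.proj (⋃ n, s n) x‖ ^ 2) := by
        rw [E.norm_sq_proj (MeasurableSet.iUnion hs)]
        simp_rw [fun n => E.norm_sq_proj (hs n) x]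
        exact h2
      rw [← h3.tsum_eq, ENNReal.ofReal_tsum_of_nonneg (fun n => sq_nonneg _) h3.summable])

/-- `T` is the bounded operator `∫ g dE`. -/
def IsIntegral (E : SpectralMeasure X H) (g : X → ℂ) (T : H →L[ℂ] H) : Prop :=
  ∀ x, Integrable g (E.measure x) ∧ inner ℂ x (T x) = ∫ w, g w ∂E.measure x

/-- The image of a spectral measure under a measurable map. -/
def map (E : SpectralMeasure X H) (f : X → Y) (hf : Measurable f) : SpectralMeasure Y H where
  proj s := E.proj (f ⁻¹' s)
  isStarProjection s hs := E.isStarProjection _ (hf hs)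
  proj_univ := E.proj_univ
  hasSum s hs hd x := by
    rw [Set.preimage_iUnion]
    exact E.hasSum _ (fun n => hf (hs n)) (fun i j hij => (hd hij).preimage f) x

end SpectralMeasure

/-- `E` is the joint spectral measure of `P ⊗ 1` and `1 ⊗ P`, where `P` is the generator of
translations on `H¹`: the translations `T₀(s) ⊗ T₀(t)` leave `H¹ ⊗ H¹` invariant, and they
restrict to `exp(is(P ⊗ 1) + it(1 ⊗ P)) = ∫ exp(i(sλ + tμ)) dE(λ, μ)`. -/
def IsJointMomentumMeasure (E : SpectralMeasure (ℝ × ℝ) BosePair) : Prop :=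
  ∀ s t : ℝ, ∃ U : BosePair →L[ℂ] BosePair,
    (∀ Ψ, translation s t (embed Ψ) = embed (U Ψ)) ∧
    E.IsIntegral (fun w => Complex.exp (Complex.I * ((s * w.1 + t * w.2 : ℝ) : ℂ))) U

/-- `T = g(P ⊗ P)`: the spectral measure of `P ⊗ P` is the image of the joint spectral measure of
`P ⊗ 1` and `1 ⊗ P` under `(λ, μ) ↦ λ μ`. -/
def IsFunctionOfMomentumProduct (g : ℝ → ℂ) (T : BosePair →L[ℂ] BosePair) : Prop :=
  ∃ E : SpectralMeasure (ℝ × ℝ) BosePair, IsJointMomentumMeasure E ∧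
    (E.map (fun w => w.1 * w.2) (measurable_fst.mul measurable_snd)).IsIntegral g T

end

end FermiScattering

namespace FermiScattering

/-! ### Bounded analytic functions on the upper half-plane -/

/-! Compression. `S_φ` multiplies by a function of the fermion momenta, and a vector in the range of
`embed` depends, apart from charge signs, only on the total momenta `s = p + q` and `t = p̄ + q̄`.
In the variables `s` and `u = p / s` the measure `dp dq` becomes `s ds du` with `0 < u < 1`: the
bosonic measure times the uniform distribution (`measurePreserving_pairMap`). So `ι* S_φ ι` is
multiplication by the average over `(u, v)` of the scattering symbol at `p = su`, `q = s(1-u)`, `p̄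
= tv`, `q̄ = t(1-v)`. The four pairs of modes contribute `φ(st·uv)`, `φ(st(1-u)(1-v))`,
`φ̌(st·u(1-v))` and `φ̌(st(1-u)v)`, whose product is the integrand of `φ̃(st)` after the
substitution `x = st·u` (`phiTilde_eq_integral`, `integral_scatteringSymbol`). Since `e = ι ι*`,
this gives `e S_φ e`.

Functional calculus. On `L²` of the momenta, multiplication by indicator functions is a spectral
measure, and multiplication by a bounded function is its integral (`isIntegral_mulOp`). Translations
act on the range of `embed` by a phase in `s` and `t` alone (`translation_embed`), so this is the
joint spectral measure of `P ⊗ 1` and `1 ⊗ P`.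

Analyticity. The maximum principle `norm_le_of_ae_boundary_le` gives `|Φ| ≤ 1` on the half-plane.
Replacing `φ` by `Φ` and `φ̌` by `z ↦ conj Φ(-conj z)` in the average over the unit square gives
`F`, which is bounded by `1` and holomorphic. For `p ≠ 0` almost every `(u, v)` places all four
arguments where the boundary limit exists, so dominated convergence gives the limit at every such
`p`. The bound on `φ̃` itself holds because its integrand is unimodular almost everywhere. -/

theorem isOpen_upperHalf : IsOpen upperHalf := isOpen_lt continuous_const Complex.continuous_im

/-- The Cayley transform of the unit disc onto the upper half-plane. -/
noncomputable def cayley (w : ℂ) : ℂ := Complex.I * ((1 + w) / (1 - w))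

theorem cayley_im (w : ℂ) : (cayley w).im = (1 - ‖w‖ ^ 2) / Complex.normSq (1 - w) := by
  rw [cayley, Complex.mul_im, Complex.I_re, Complex.I_im, zero_mul, zero_add, one_mul,
    Complex.div_re, ← Complex.normSq_eq_norm_sq, Complex.normSq_apply w]
  simp
  ring

theorem cayley_im_nonneg {w : ℂ} (h : ‖w‖ ≤ 1) : 0 ≤ (cayley w).im := by
  rw [cayley_im]
  refine div_nonneg ?_ (Complex.normSq_nonneg _)
  nlinarith [norm_nonneg w]

theorem differentiableAt_cayley {w : ℂ} (h : w ≠ 1) : DifferentiableAt ℂ cayley w := by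
  have : 1 - w ≠ 0 := sub_ne_zero.2 h.symm
  unfold cayley
  fun_prop (disch := assumption)

/-- Half angles: `exp(iθ) = (c + is)²` with `c = cos(θ/2)`, `s = sin(θ/2)`, and `c² + s² = 1` turns
numerator and denominator into `2c(c + is)` and `-2is(c + is)`, whose quotient times `i` is `-c/s`.
-/
theorem cayley_circleMap {θ : ℝ} (h : θ ∈ Set.Ioo 0 (2 * Real.pi)) :
    cayley (circleMap 0 1 θ) = ((-(Real.cos (θ / 2) / Real.sin (θ / 2)) : ℝ) : ℂ) := by
  have hs : 0 < Real.sin (θ / 2) :=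
    Real.sin_pos_of_pos_of_lt_pi (by linarith [h.1]) (by linarith [h.2])
  have hsc : (Real.sin (θ / 2) : ℂ) ≠ 0 := by exact_mod_cast hs.ne'
  have he : Complex.exp (θ * Complex.I) =
      ((Real.cos (θ / 2) : ℂ) + Real.sin (θ / 2) * Complex.I) ^ 2 := by
    have : (θ : ℂ) * Complex.I = ((2 : ℕ) : ℂ) * (((θ / 2 : ℝ) : ℂ) * Complex.I) := by
      push_cast; ring
    rw [this, Complex.exp_nat_mul, Complex.exp_mul_I, Complex.ofReal_cos, Complex.ofReal_sin]
  have h1 : (Real.cos (θ / 2) : ℂ) ^ 2 + (Real.sin (θ / 2) : ℂ) ^ 2 = 1 := by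
    exact_mod_cast Real.cos_sq_add_sin_sq (θ / 2)
  have hne : (Real.cos (θ / 2) : ℂ) + Real.sin (θ / 2) * Complex.I ≠ 0 := by
    intro h0
    have := congrArg Complex.im h0
    simp only [Complex.add_im, Complex.ofReal_im, Complex.im_ofReal_mul, Complex.I_im,
      Complex.zero_im] at this
    linarith
  have hI := Complex.I_sq
  rw [cayley, circleMap, zero_add, Complex.ofReal_one, one_mul, he, Complex.ofReal_neg,
    Complex.ofReal_div]
  generalize (Real.cos (θ / 2) : ℂ) = c at *
  generalize (Real.sin (θ / 2) : ℂ) = s at *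
  have e1 : 1 + (c + s * Complex.I) ^ 2 = 2 * c * (c + s * Complex.I) := by
    linear_combination (-1 : ℂ) * h1 + s ^ 2 * hI
  have e2 : 1 - (c + s * Complex.I) ^ 2 = -2 * Complex.I * s * (c + s * Complex.I) := by
    linear_combination (-1 : ℂ) * h1 + s ^ 2 * hI
  rw [e1, e2]
  have hI0 := Complex.I_ne_zero
  rw [mul_comm s] at hne ⊢
  field_simp

/-- The inverse parametrization `t ↦ π + 2 arctan t` is differentiable, hence carries null sets of
the line to null sets of angles. -/
theorem ae_cayley_circleMap {q : ℝ → Prop} (hq : ∀ᵐ t : ℝ, q t) :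
    ∀ᵐ θ : ℝ, θ ∈ Set.Ioo 0 (2 * Real.pi) →
      q (-(Real.cos (θ / 2) / Real.sin (θ / 2))) := by
  rw [ae_iff] at hq ⊢
  have hd : DifferentiableOn ℝ (fun t : ℝ => Real.pi + 2 * Real.arctan t) {t | ¬ q t} :=
    ((Real.differentiable_arctan.const_mul 2).const_add Real.pi).differentiableOn
  refine measure_mono_null ?_
    (addHaar_image_eq_zero_of_differentiableOn_of_addHaar_eq_zero volume hd hq)
  intro θ hθ
  simp only [Classical.not_imp, Set.mem_ofPred_eq] at hθ
  refine ⟨_, hθ.2, ?_⟩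
  have h1 : -(Real.cos (θ / 2) / Real.sin (θ / 2)) = Real.tan (θ / 2 - Real.pi / 2) := by
    rw [Real.tan_eq_sin_div_cos, Real.sin_sub_pi_div_two, Real.cos_sub_pi_div_two, neg_div]
  simp only
  rw [h1, Real.arctan_tan (by linarith [hθ.1.1]) (by linarith [hθ.1.2])]
  ring

/-- The mean value property on the unit circle with one boundary point removed. -/
theorem integral_circleMap_of_bounded {g : ℂ → ℂ} {C : ℝ}
    (hg : ∀ w, ‖w‖ ≤ 1 → w ≠ 1 → DifferentiableAt ℂ g w)
    (hC : ∀ w, ‖w‖ ≤ 1 → w ≠ 1 → ‖g w‖ ≤ C) :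
    ∫ θ in (0 : ℝ)..2 * Real.pi, g (circleMap 0 1 θ) = (2 * Real.pi : ℝ) • g 0 := by
  have hr : ∀ᶠ r : ℝ in 𝓝[<] 1, 0 < r ∧ r < 1 :=
    Ioo_mem_nhdsLT (show (0 : ℝ) < 1 by norm_num)
  have hn : ∀ r : ℝ, 0 < r → ∀ θ, ‖circleMap 0 r θ‖ = r := fun r h θ => by
    rw [norm_circleMap_zero, abs_of_pos h]
  have hne : ∀ r : ℝ, 0 < r → r < 1 → ∀ θ, circleMap 0 r θ ≠ 1 := fun r h h' θ e => by
    have := hn r h θ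
    rw [e, norm_one] at this
    exact h'.ne this.symm
  -- Smaller circles avoid the exceptional point `1`, so the mean value property holds on them;
  -- letting the radius tend to `1` is justified by the bound `C`.
  have hlim : Tendsto (fun r : ℝ => ∫ θ in (0 : ℝ)..2 * Real.pi, g (circleMap 0 r θ)) (𝓝[<] 1)
      (𝓝 (∫ θ in (0 : ℝ)..2 * Real.pi, g (circleMap 0 1 θ))) := by
    refine intervalIntegral.tendsto_integral_filter_of_dominated_convergence (fun _ => C)
      ?_ ?_ intervalIntegrable_const ?_
    · filter_upwards [hr] with r h
      refine (Continuous.aestronglyMeasurable ?_)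
      refine continuous_iff_continuousAt.2 fun θ => ?_
      exact ContinuousAt.comp (hg _ (by rw [hn r h.1]; exact h.2.le)
        (hne r h.1 h.2 θ)).continuousAt (continuous_circleMap 0 r).continuousAt
    · filter_upwards [hr] with r h
      exact Eventually.of_forall fun θ _ => hC _ (by rw [hn r h.1]; exact h.2.le)
        (hne r h.1 h.2 θ)
    -- On `(0, 2π]` only `θ = 2π` is sent to the point `1`.
    · have hae : ∀ᵐ θ : ℝ, θ ≠ 2 * Real.pi := by simp [ae_iff]
      filter_upwards [hae] with θ h2 hθ
      rw [Set.uIoc_of_le (by positivity)] at hθ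
      have h1 : circleMap 0 1 θ ≠ 1 := by
        intro e
        have e' : circleMap 0 1 θ = circleMap 0 1 (2 * Real.pi) := by
          rw [e]; simp [circleMap]
        have := injOn_circleMap_of_abs_sub_le (c := 0) one_ne_zero (a := 0) (b := 2 * Real.pi)
          (by simp [abs_of_pos Real.pi_pos]) (by rwa [Set.uIoc_of_le (by positivity)])
          (by rw [Set.uIoc_of_le (by positivity)]; exact ⟨by positivity, le_rfl⟩) e'
        exact h2 this
      refine ((hg _ (by rw [hn 1 one_pos]) h1).continuousAt.tendsto).comp ?_
      have : Continuous fun r : ℝ => circleMap 0 r θ := by unfold circleMap; fun_prop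
      exact (this.tendsto 1).mono_left nhdsWithin_le_nhds
  refine tendsto_nhds_unique hlim (tendsto_const_nhds.congr' ?_)
  filter_upwards [hr] with r h
  have h1 : DiffContOnCl ℂ g (Metric.ball 0 |r|) := by
    refine DifferentiableOn.diffContOnCl fun w hw => ?_
    rw [closure_ball _ (abs_pos.2 h.1.ne').ne', abs_of_pos h.1, mem_closedBall_zero_iff] at hw
    refine (hg w (hw.trans h.2.le) ?_).differentiableWithinAt
    rintro rfl
    rw [norm_one] at hw
    linarith [h.2]
  have h2 := h1.circleAverage
  rw [Real.circleAverage] at h2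
  rw [← h2, smul_smul, mul_inv_cancel₀ (by positivity), one_smul]

/-- The maximum principle: a bounded analytic function on the upper half-plane is bounded by the
supremum of its boundary values. -/
theorem norm_le_of_ae_boundary_le {Φ : ℂ → ℂ} {φ : ℝ → ℂ} {B C : ℝ}
    (hd : DifferentiableOn ℂ Φ upperHalf) (hC : ∀ z ∈ upperHalf, ‖Φ z‖ ≤ C)
    (hb : ∀ᵐ x : ℝ, Tendsto (fun y : ℝ => Φ (x + y * Complex.I)) (𝓝[>] 0) (𝓝 (φ x)))
    (hB : ∀ᵐ x : ℝ, ‖φ x‖ ≤ B) {z : ℂ} (hz : z ∈ upperHalf) : ‖Φ z‖ ≤ B := by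
  have hy : 0 < z.im := hz
  -- `M 0` is the conformal map of the disc with `0 ↦ z`, as `cayley 0 = i`. The shift by `iε` moves
  -- the image of the closed disc into the open half-plane, where `Φ` is analytic and bounded.
  set M : ℝ → ℂ → ℂ := fun ε w => z.re + z.im * cayley w + ε * Complex.I with hM
  have hMim : ∀ ε : ℝ, 0 < ε → ∀ w, ‖w‖ ≤ 1 → M ε w ∈ upperHalf := by
    intro ε hε w hw
    have h1 := cayley_im_nonneg hw
    simp only [hM, upperHalf, Set.mem_ofPred_eq, Complex.add_im, Complex.ofReal_im,
      Complex.im_ofReal_mul, Complex.I_im]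
    positivity
  have hdiff : ∀ ε : ℝ, 0 < ε → ∀ w, ‖w‖ ≤ 1 → w ≠ 1 →
      DifferentiableAt ℂ (fun w => Φ (M ε w)) w := by
    intro ε hε w hw hw1
    have h1 := hMim ε hε w hw
    have h2 := differentiableAt_cayley hw1
    exact DifferentiableAt.comp w (hd.differentiableAt (isOpen_upperHalf.mem_nhds h1))
      (by simp only [hM]; fun_prop)
  have hmean : ∀ ε : ℝ, 0 < ε → ∫ θ in (0 : ℝ)..2 * Real.pi, Φ (M ε (circleMap 0 1 θ)) =
      (2 * Real.pi : ℝ) • Φ (M ε 0) := fun ε hε =>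
    integral_circleMap_of_bounded (hdiff ε hε) (C := C) fun w hw _ => hC _ (hMim ε hε w hw)
  set c : ℝ → ℝ := fun θ => z.re + z.im * -(Real.cos (θ / 2) / Real.sin (θ / 2)) with hc
  have hcM : ∀ ε θ, θ ∈ Set.Ioo 0 (2 * Real.pi) →
      M ε (circleMap 0 1 θ) = (c θ : ℂ) + ε * Complex.I := by
    intro ε θ hθ
    simp only [hM, hc]
    rw [cayley_circleMap hθ]
    push_cast; ring
  have hcc : ContinuousOn c (Set.Ioo 0 (2 * Real.pi)) := by
    have : ∀ θ ∈ Set.Ioo 0 (2 * Real.pi), Real.sin (θ / 2) ≠ 0 := fun θ h =>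
      (Real.sin_pos_of_pos_of_lt_pi (by linarith [h.1]) (by linarith [h.2])).ne'
    simp only [hc]
    fun_prop (disch := assumption)
  have haff : ∀ {q : ℝ → Prop}, (∀ᵐ x : ℝ, q x) → ∀ᵐ t : ℝ, q (z.re + z.im * t) := by
    intro q h
    have h1 : ∀ᵐ t : ℝ, q (z.re + t) :=
      (measurePreserving_add_left volume z.re).quasiMeasurePreserving.ae h
    rw [ae_iff] at h1 ⊢
    have : {t : ℝ | ¬ q (z.re + z.im * t)} = (fun t => z.im * t) ⁻¹' {t | ¬ q (z.re + t)} := rfl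
    rw [this, Real.volume_preimage_mul_left hy.ne', h1, mul_zero]
  have hae : ∀ {p : ℝ → Prop}, (∀ᵐ θ, θ ∈ Set.Ioo 0 (2 * Real.pi) → p θ) →
      ∀ᵐ θ : ℝ, θ ∈ Set.uIoc 0 (2 * Real.pi) → p θ := by
    intro p hp
    have h2 : ∀ᵐ θ : ℝ, θ ≠ 2 * Real.pi := by simp [ae_iff]
    filter_upwards [hp, h2] with θ h h' hθ
    rw [Set.uIoc_of_le (by positivity)] at hθ
    exact h ⟨hθ.1, lt_of_le_of_ne hθ.2 h'⟩
  have hlim : Tendsto (fun ε : ℝ => ∫ θ in (0 : ℝ)..2 * Real.pi, Φ (M ε (circleMap 0 1 θ)))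
      (𝓝[>] 0) (𝓝 (∫ θ in (0 : ℝ)..2 * Real.pi, φ (c θ))) := by
    refine intervalIntegral.tendsto_integral_filter_of_dominated_convergence (fun _ => C)
      ?_ ?_ intervalIntegrable_const ?_
    · filter_upwards [self_mem_nhdsWithin] with ε hε
      rw [Set.uIoc_of_le (by positivity), ← restrict_Ioo_eq_restrict_Ioc]
      refine ContinuousOn.aestronglyMeasurable ?_ measurableSet_Ioo
      have h1 : ContinuousOn (fun θ => Φ ((c θ : ℂ) + ε * Complex.I))
          (Set.Ioo 0 (2 * Real.pi)) := by
        refine hd.continuousOn.comp (by fun_prop) fun θ _ => ?_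
        simpa [upperHalf] using hε
      exact h1.congr fun θ hθ => by rw [hcM ε θ hθ]
    · filter_upwards [self_mem_nhdsWithin] with ε hε
      exact Eventually.of_forall fun θ _ => hC _ (hMim ε hε _ (by simp))
    · refine hae ?_
      filter_upwards [ae_cayley_circleMap (haff hb)] with θ h hθ
      refine (h hθ).congr fun ε => ?_
      rw [hcM ε θ hθ]
  have hlim2 : Tendsto (fun ε : ℝ => (2 * Real.pi : ℝ) • Φ (M ε 0)) (𝓝[>] 0)
      (𝓝 ((2 * Real.pi : ℝ) • Φ z)) := by
    have hM0 : M 0 0 = z := by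
      simp only [hM, cayley]
      simp
    refine Tendsto.const_smul ?_ _
    have h1 : ContinuousAt Φ (M 0 0) := by
      rw [hM0]; exact (hd.differentiableAt (isOpen_upperHalf.mem_nhds hz)).continuousAt
    have h2 : Continuous fun ε : ℝ => M ε 0 := by simp only [hM]; fun_prop
    have h3 := (ContinuousAt.comp (f := fun ε : ℝ => M ε 0) h1 h2.continuousAt).tendsto
    simp only [Function.comp_def, hM0] at h3
    exact h3.mono_left nhdsWithin_le_nhds
  -- Letting `ε → 0` in the mean value identity represents `Φ z` as an average of boundary values,
  -- and the crude bound `C` can then be replaced by `B`.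
  have heq : ∫ θ in (0 : ℝ)..2 * Real.pi, φ (c θ) = (2 * Real.pi : ℝ) • Φ z := by
    refine tendsto_nhds_unique hlim (hlim2.congr' ?_)
    filter_upwards [self_mem_nhdsWithin] with ε hε using (hmean ε hε).symm
  have hle : ‖∫ θ in (0 : ℝ)..2 * Real.pi, φ (c θ)‖ ≤ B * |2 * Real.pi - 0| :=
    intervalIntegral.norm_integral_le_of_norm_le_const_ae
      (hae (ae_cayley_circleMap (haff hB)))
  rw [heq, norm_smul, Real.norm_eq_abs, sub_zero, mul_comm] at hle
  exact le_of_mul_le_mul_right hle (by positivity)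

/-- The integral of a bounded family of holomorphic functions is holomorphic. -/
theorem differentiableOn_integral_of_norm_le {α : Type*} [MeasurableSpace α] {μ : Measure α}
    [IsFiniteMeasure μ] {U : Set ℂ} (hU : IsOpen U) {f : ℂ → α → ℂ} {C : ℝ}
    (hm : ∀ z ∈ U, AEStronglyMeasurable (f z) μ)
    (hd : ∀ᵐ a ∂μ, DifferentiableOn ℂ (fun z => f z a) U)
    (hC : ∀ᵐ a ∂μ, ∀ z ∈ U, ‖f z a‖ ≤ C) :
    DifferentiableOn ℂ (fun z => ∫ a, f z a ∂μ) U := by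
  intro z₀ hz₀
  obtain ⟨R, hR, hball⟩ := Metric.isOpen_iff.1 hU z₀ hz₀
  have hsub : ∀ z ∈ Metric.ball z₀ (R / 2), Metric.closedBall z (R / 4) ⊆ U := by
    intro z hz w hw
    refine hball ?_
    rw [Metric.mem_ball] at hz ⊢
    rw [Metric.mem_closedBall] at hw
    linarith [dist_triangle w z z₀]
  have hmem : ∀ z ∈ Metric.ball z₀ (R / 2), z ∈ U := fun z hz =>
    hsub z hz (Metric.mem_closedBall_self (by positivity))
  have hder : ∀ᵐ a ∂μ, ∀ z ∈ Metric.ball z₀ (R / 2),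
      HasDerivAt (fun z => f z a) (deriv (fun z => f z a) z) z := by
    filter_upwards [hd] with a ha z hz
    exact (ha.differentiableAt (hU.mem_nhds (hmem z hz))).hasDerivAt
  have hz₀' : z₀ ∈ Metric.ball z₀ (R / 2) := Metric.mem_ball_self (by positivity)
  -- Around each point of the ball of radius `R / 2` there is a closed disc of radius `R / 4` inside
  -- `U`, so Cauchy's estimate dominates the derivative by `C / (R / 4)`.
  refine (hasDerivAt_integral_of_dominated_loc_of_deriv_le (s := Metric.ball z₀ (R / 2))
    (bound := fun _ => C / (R / 4)) (F' := fun z a => deriv (fun z => f z a) z)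
    (Metric.ball_mem_nhds _ (by positivity)) ?_ ?_ ?_ ?_ (integrable_const _)
    hder).2.differentiableAt.differentiableWithinAt
  · filter_upwards [hU.mem_nhds hz₀] with z hz using hm z hz
  · refine Integrable.of_bound (hm z₀ hz₀) C ?_
    filter_upwards [hC] with a ha using ha z₀ hz₀
  -- Measurability in `a` of the derivative at `z₀`: it is an almost everywhere limit of difference
  -- quotients, with steps at most `R / 4` so that the points stay in `U`.
  · have hu : Tendsto (fun n : ℕ => (((R / 4) * (1 / ((n : ℝ) + 1)) : ℝ) : ℂ)) atTop (𝓝[≠] 0) := by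
      refine tendsto_nhdsWithin_iff.2 ⟨?_, Eventually.of_forall fun n => ?_⟩
      · have := (tendsto_one_div_add_atTop_nhds_zero_nat (𝕜 := ℝ)).const_mul (R / 4)
        rw [mul_zero] at this
        exact (Complex.continuous_ofReal.tendsto' 0 0 (by simp)).comp this
      · simp only [Set.mem_compl_iff, Set.mem_singleton_iff, Complex.ofReal_eq_zero]
        positivity
    refine aestronglyMeasurable_of_tendsto_ae atTop (f := fun (n : ℕ) a =>
      (((R / 4) * (1 / ((n : ℝ) + 1)) : ℝ) : ℂ)⁻¹ •
        (f (z₀ + (((R / 4) * (1 / ((n : ℝ) + 1)) : ℝ) : ℂ)) a - f z₀ a)) (fun n => ?_) ?_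
    · refine ((hm _ ?_).sub (hm z₀ hz₀)).const_smul (_ : ℂ)
      refine hsub z₀ hz₀' ?_
      rw [Metric.mem_closedBall, dist_eq_norm, add_sub_cancel_left, Complex.norm_real,
        Real.norm_eq_abs, abs_of_pos (by positivity)]
      have : (1 : ℝ) / ((n : ℝ) + 1) ≤ 1 := by
        rw [div_le_one (by positivity)]; linarith [(Nat.cast_nonneg n : (0 : ℝ) ≤ n)]
      nlinarith
    · filter_upwards [hder] with a ha
      exact (hasDerivAt_iff_tendsto_slope_zero.1 (ha z₀ hz₀')).comp hu
  · filter_upwards [hd, hC] with a ha hCa z hz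
    refine Complex.norm_deriv_le_of_forall_mem_sphere_norm_le (by positivity) ?_ fun w hw =>
      hCa w (hsub z hz (Metric.sphere_subset_closedBall hw))
    refine DifferentiableOn.diffContOnCl ?_
    rw [closure_ball _ (by positivity)]
    exact ha.mono (hsub z hz)

/-! ### The function `φ̃` as an average over the unit square -/

/-- The uniform distribution on the unit interval. -/
noncomputable def unif : Measure ℝ := volume.restrict (Set.Ioo (0 : ℝ) 1)

instance : IsProbabilityMeasure unif := ⟨by simp [unif]⟩

theorem ae_unif_mem : ∀ᵐ u ∂unif, u ∈ Set.Ioo (0 : ℝ) 1 := ae_restrict_mem measurableSet_Ioo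

theorem measurePreserving_one_sub_unif : MeasurePreserving (fun u : ℝ => 1 - u) unif unif := by
  have h := (Measure.measurePreserving_sub_left volume (1 : ℝ)).restrict_preimage
    (s := Set.Ioo (0 : ℝ) 1) measurableSet_Ioo
  have e : (fun u : ℝ => 1 - u) ⁻¹' Set.Ioo (0 : ℝ) 1 = Set.Ioo 0 1 := by
    ext u; simp
  rwa [e] at h

theorem ae_unif_mem_prod :
    ∀ᵐ w ∂unif.prod unif, w.1 ∈ Set.Ioo (0 : ℝ) 1 ∧ w.2 ∈ Set.Ioo (0 : ℝ) 1 :=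
  (Measure.quasiMeasurePreserving_fst.ae ae_unif_mem).and
    (Measure.quasiMeasurePreserving_snd.ae ae_unif_mem)

theorem intervalIntegral_eq_integral_unif (f : ℝ → ℂ) :
    ∫ u in (0 : ℝ)..1, f u = ∫ u, f u ∂unif := by
  rw [intervalIntegral.integral_of_le zero_le_one, unif, restrict_Ioo_eq_restrict_Ioc]

/-- For fixed `u ≠ 0` the map `t ↦ put` is a dilation and preserves null sets; Fubini does the rest,
once the exceptional set is enlarged to a measurable null set. -/
theorem ae_unif_mul {q : ℝ → Prop} (hq : ∀ᵐ t : ℝ, q t) {p : ℝ} (hp : p ≠ 0) :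
    ∀ᵐ w ∂unif.prod unif, q (p * (w.1 * w.2)) := by
  obtain ⟨s, hs, hsm, h0⟩ := exists_measurable_superset_of_null (ae_iff.1 hq)
  have key : ∀ᵐ w ∂unif.prod unif, p * (w.1 * w.2) ∉ s := by
    have hms : MeasurableSet {w : ℝ × ℝ | p * (w.1 * w.2) ∉ s} :=
      (show Measurable fun w : ℝ × ℝ => p * (w.1 * w.2) by fun_prop) hsm.compl
    rw [Measure.ae_prod_iff_ae_ae hms]
    filter_upwards [ae_unif_mem] with u hu
    refine ae_restrict_of_ae ?_
    rw [ae_iff]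
    have : {t : ℝ | ¬ p * (u * t) ∉ s} = (fun t => (p * u) * t) ⁻¹' s := by
      ext t; simp [mul_assoc]
    rw [this, Real.volume_preimage_mul_left (mul_ne_zero hp hu.1.ne'), h0, mul_zero]
  filter_upwards [key] with w hw
  by_contra hc
  exact hw (hs hc)

/-- The reflection `u ↦ 1 - u` preserves the uniform distribution, so the four arguments in `kernel`
reduce to the product `w.1 * w.2`. -/
theorem ae_unif_mul_all {q : ℝ → Prop} (hq : ∀ᵐ t : ℝ, q t) {p : ℝ} (hp : p ≠ 0) :
    ∀ᵐ w ∂unif.prod unif, q (p * ((1 - w.1) * (1 - w.2))) ∧ q (p * (w.1 * w.2)) ∧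
      q (p * ((1 - w.1) * w.2)) ∧ q (p * (w.1 * (1 - w.2))) := by
  have h := ae_unif_mul hq hp
  have hr := measurePreserving_one_sub_unif
  have hi := MeasurePreserving.id unif
  filter_upwards [(hr.prod hr).quasiMeasurePreserving.ae h, h,
    (hr.prod hi).quasiMeasurePreserving.ae h, (hi.prod hr).quasiMeasurePreserving.ae h]
    with w h1 h2 h3 h4
  exact ⟨h1, h2, h3, h4⟩

theorem ae_neg {q : ℝ → Prop} (hq : ∀ᵐ t : ℝ, q t) : ∀ᵐ t : ℝ, q (-t) :=
  (Measure.measurePreserving_neg volume).quasiMeasurePreserving.ae hq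

/-- The integrand of `φ̃` after rescaling to the unit square. -/
noncomputable def kernel (φ : ℝ → ℂ) (p : ℝ) (w : ℝ × ℝ) : ℂ :=
  φ (p * ((1 - w.1) * (1 - w.2))) * φ (p * (w.1 * w.2)) *
    check φ (p * ((1 - w.1) * w.2)) * check φ (p * (w.1 * (1 - w.2)))

theorem norm_check (φ : ℝ → ℂ) (p : ℝ) : ‖check φ p‖ = ‖φ (-p)‖ := RCLike.norm_conj _

theorem norm_kernel {φ : ℝ → ℂ} (h1 : ∀ x, ‖φ x‖ = 1) (p : ℝ) (w : ℝ × ℝ) :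
    ‖kernel φ p w‖ = 1 := by
  simp [kernel, norm_check, h1]

theorem measurable_check {φ : ℝ → ℂ} (hm : Measurable φ) : Measurable (check φ) :=
  Complex.continuous_conj.measurable.comp (hm.comp measurable_neg)

theorem measurable_kernel {φ : ℝ → ℂ} (hm : Measurable φ) :
    Measurable fun v : ℝ × ℝ × ℝ => kernel φ v.1 v.2 := by
  have hc := measurable_check hm
  unfold kernel
  fun_prop

theorem kernel_ae_eq {φ φ₀ : ℝ → ℂ} (h : φ =ᵐ[volume] φ₀) {p : ℝ} (hp : p ≠ 0) :
    kernel φ p =ᵐ[unif.prod unif] kernel φ₀ p := by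
  filter_upwards [ae_unif_mul_all h hp, ae_unif_mul_all (ae_neg h) hp] with w h1 h2
  simp only [kernel, check]
  rw [h1.1, h1.2.1, h2.2.2.1, h2.2.2.2]

/-- The substitution `x = pu` (also for negative `p`) cancels the prefactor `1/p`. The
representative `φ₀` makes the integrand measurable, so that Fubini combines the iterated integral
into one over the square. -/
theorem phiTilde_eq_integral {φ φ₀ : ℝ → ℂ} (h : φ =ᵐ[volume] φ₀) (hm : Measurable φ₀)
    (h1 : ∀ x, ‖φ₀ x‖ = 1) {p : ℝ} (hp : p ≠ 0) :
    phiTilde φ p = ∫ w, kernel φ₀ p w ∂unif.prod unif := by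
  have hint : Integrable (kernel φ₀ p) (unif.prod unif) :=
    Integrable.of_bound
      ((measurable_kernel hm).comp (measurable_const.prodMk measurable_id)).aestronglyMeasurable 1
      (Eventually.of_forall fun w => (norm_kernel h1 p w).le)
  have hae := kernel_ae_eq h hp
  rw [← integral_congr_ae hae, integral_prod _ (hint.congr hae.symm),
    ← intervalIntegral_eq_integral_unif, phiTilde]
  have e := intervalIntegral.integral_comp_mul_left (a := 0) (b := 1) (fun x : ℝ =>
    ∫ y in (0 : ℝ)..1, φ ((p - x) * (1 - y)) * φ (x * y) * check φ ((p - x) * y) *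
      check φ (x * (1 - y))) hp
  rw [mul_zero, mul_one, Complex.real_smul, Complex.ofReal_inv] at e
  rw [← e]
  refine intervalIntegral.integral_congr fun u _ => ?_
  rw [← intervalIntegral_eq_integral_unif]
  refine intervalIntegral.integral_congr fun v _ => ?_
  simp only [kernel]
  ring_nf

theorem phiTilde_zero (φ : ℝ → ℂ) : phiTilde φ 0 = 0 := by simp [phiTilde]

/-- `φ` is only almost everywhere measurable and unimodular. A representative with both properties
everywhere makes `kernel` jointly measurable and of modulus `1` without exceptional sets. -/
theorem IsInner.exists_measurable {φ : ℝ → ℂ} (h : IsInner φ) :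
    ∃ φ₀ : ℝ → ℂ, Measurable φ₀ ∧ φ =ᵐ[volume] φ₀ ∧ ∀ x, ‖φ₀ x‖ = 1 := by
  obtain ⟨ψ, hm, he⟩ := h.aemeasurable
  have hs : MeasurableSet {x | ‖ψ x‖ = 1} := measurableSet_eq_fun hm.norm measurable_const
  classical
  refine ⟨fun x => if ‖ψ x‖ = 1 then ψ x else 1, hm.ite hs measurable_const, ?_, fun x => ?_⟩
  · filter_upwards [he, h.norm_eq_one] with x hx h1
    rw [hx] at h1
    rw [if_pos h1, hx]
  · dsimp only
    split_ifs with hx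
    · exact hx
    · simp

theorem norm_phiTilde_le {φ : ℝ → ℂ} (h : IsInner φ) (p : ℝ) : ‖phiTilde φ p‖ ≤ 1 := by
  rcases eq_or_ne p 0 with rfl | hp
  · simp [phiTilde_zero]
  obtain ⟨φ₀, hm, he, h1⟩ := h.exists_measurable
  rw [phiTilde_eq_integral he hm h1 hp]
  have := norm_integral_le_of_norm_le_const (μ := unif.prod unif)
    (Eventually.of_forall fun w => (norm_kernel h1 p w).le)
  simpa using this

theorem measurable_phiTilde {φ : ℝ → ℂ} (h : IsInner φ) : Measurable (phiTilde φ) := by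
  obtain ⟨φ₀, hm, he, h1⟩ := h.exists_measurable
  have h2 : Measurable fun p : ℝ => ∫ w, kernel φ₀ p w ∂unif.prod unif :=
    ((measurable_kernel hm).stronglyMeasurable.integral_prod_right).measurable
  classical
  -- The point `0` needs separate treatment: the averaged kernel equals `|φ₀(0)|⁴ = 1` there, while
  -- `phiTilde φ 0 = 0`.
  have h3 : phiTilde φ = fun p => if p = 0 then 0 else ∫ w, kernel φ₀ p w ∂unif.prod unif := by
    ext p
    split_ifs with hp
    · rw [hp, phiTilde_zero]
    · exact phiTilde_eq_integral he hm h1 hp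
  rw [h3]
  exact Measurable.ite (measurableSet_singleton 0) measurable_const h2

/-! ### Analytic extension of `φ̃` to the upper half-plane -/

/-- The analytic extension of `φ̌`. -/
noncomputable def checkExt (Φ : ℂ → ℂ) (z : ℂ) : ℂ :=
  (starRingEnd ℂ) (Φ (-(starRingEnd ℂ) z))

theorem neg_conj_mem_upperHalf {z : ℂ} (hz : z ∈ upperHalf) :
    -(starRingEnd ℂ) z ∈ upperHalf := by
  simpa [upperHalf] using hz

theorem differentiableOn_checkExt {Φ : ℂ → ℂ} (hd : DifferentiableOn ℂ Φ upperHalf) :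
    DifferentiableOn ℂ (checkExt Φ) upperHalf := by
  intro z hz
  have h1 := hd.differentiableAt (isOpen_upperHalf.mem_nhds (neg_conj_mem_upperHalf hz))
  have h2 : DifferentiableAt ℂ (fun w => Φ (-w)) ((starRingEnd ℂ) z) :=
    DifferentiableAt.comp (f := fun w : ℂ => -w) _ h1 differentiableAt_id.neg
  have h3 := h2.conj_conj
  rw [Complex.conj_conj] at h3
  exact h3.differentiableWithinAt

theorem ofReal_mul_mem_upperHalf {z : ℂ} (hz : z ∈ upperHalf) {a : ℝ} (ha : 0 < a) :
    z * (a : ℂ) ∈ upperHalf := by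
  have : 0 < z.im := hz
  simp only [upperHalf, Set.mem_ofPred_eq, Complex.im_mul_ofReal]
  positivity

/-- The four scale factors are positive on the open square, so dilation by them preserves the
half-plane and vertical approach to the real line; the extension is therefore the average of
products of extensions. -/
theorem exists_extension_phiTilde {φ : ℝ → ℂ} (h : IsInner φ) :
    ∃ F : ℂ → ℂ, DifferentiableOn ℂ F upperHalf ∧ (∀ z ∈ upperHalf, ‖F z‖ ≤ 1) ∧
      ∀ p : ℝ, p ≠ 0 → Tendsto (fun y : ℝ => F (p + y * Complex.I)) (𝓝[>] 0)
        (𝓝 (phiTilde φ p)) := by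
  obtain ⟨φ₀, hm, he, h1⟩ := h.exists_measurable
  obtain ⟨Φ, hd, ⟨C, hC⟩, hb⟩ := h.exists_extension
  -- The given bound `C` may exceed `1`; the maximum principle improves it, which is what yields
  -- `|F| ≤ 1`.
  have hΦ1 : ∀ z ∈ upperHalf, ‖Φ z‖ ≤ 1 := fun z hz =>
    norm_le_of_ae_boundary_le hd hC hb (h.norm_eq_one.mono fun x hx => hx.le) hz
  have hd' := differentiableOn_checkExt hd
  have hΦ1' : ∀ z ∈ upperHalf, ‖checkExt Φ z‖ ≤ 1 := fun z hz => by
    rw [checkExt, RCLike.norm_conj]; exact hΦ1 _ (neg_conj_mem_upperHalf hz)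
  set G : ℂ → ℝ × ℝ → ℂ := fun z w =>
    Φ (z * (((1 - w.1) * (1 - w.2) : ℝ) : ℂ)) * Φ (z * ((w.1 * w.2 : ℝ) : ℂ)) *
      checkExt Φ (z * (((1 - w.1) * w.2 : ℝ) : ℂ)) *
        checkExt Φ (z * ((w.1 * (1 - w.2) : ℝ) : ℂ)) with hG
  set Q : Set (ℝ × ℝ) := Set.Ioo (0 : ℝ) 1 ×ˢ Set.Ioo (0 : ℝ) 1 with hQ
  have hpos : ∀ w ∈ Q, 0 < (1 - w.1) * (1 - w.2) ∧ 0 < w.1 * w.2 ∧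
      0 < (1 - w.1) * w.2 ∧ 0 < w.1 * (1 - w.2) := by
    intro w hw
    have a1 := hw.1.1
    have a2 := sub_pos.2 hw.1.2
    have a3 := hw.2.1
    have a4 := sub_pos.2 hw.2.2
    exact ⟨mul_pos a2 a4, mul_pos a1 a3, mul_pos a2 a3, mul_pos a1 a4⟩
  have hμ : unif.prod unif = (volume : Measure (ℝ × ℝ)).restrict Q := by
    rw [unif, Measure.prod_restrict]; rfl
  have hcomp : ∀ {f : ℂ → ℂ}, DifferentiableOn ℂ f upperHalf → ∀ {a : ℝ}, 0 < a →
      DifferentiableOn ℂ (fun z => f (z * (a : ℂ))) upperHalf := fun hf a ha =>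
    hf.comp (by fun_prop) fun z hz => ofReal_mul_mem_upperHalf hz ha
  have hcont : ∀ {f : ℂ → ℂ}, DifferentiableOn ℂ f upperHalf → ∀ {a : ℝ × ℝ → ℝ},
      Continuous a → (∀ w ∈ Q, 0 < a w) → ∀ z ∈ upperHalf,
      ContinuousOn (fun w => f (z * (a w : ℂ))) Q := fun hf a ha hap z hz =>
    hf.continuousOn.comp (by fun_prop) fun w hw => ofReal_mul_mem_upperHalf hz (hap w hw)
  have hGm : ∀ z ∈ upperHalf, AEStronglyMeasurable (G z) (unif.prod unif) := by
    intro z hz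
    rw [hμ]
    refine ContinuousOn.aestronglyMeasurable ?_ (measurableSet_Ioo.prod measurableSet_Ioo)
    exact (((hcont hd (by fun_prop) (fun w hw => (hpos w hw).1) z hz).mul
      (hcont hd (by fun_prop) (fun w hw => (hpos w hw).2.1) z hz)).mul
      (hcont hd' (by fun_prop) (fun w hw => (hpos w hw).2.2.1) z hz)).mul
      (hcont hd' (by fun_prop) (fun w hw => (hpos w hw).2.2.2) z hz)
  have hGd : ∀ᵐ w ∂unif.prod unif, DifferentiableOn ℂ (fun z => G z w) upperHalf := by
    filter_upwards [ae_unif_mem_prod] with w hw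
    obtain ⟨p1, p2, p3, p4⟩ := hpos w hw
    exact (((hcomp hd p1).mul (hcomp hd p2)).mul (hcomp hd' p3)).mul (hcomp hd' p4)
  have hGb : ∀ᵐ w ∂unif.prod unif, ∀ z ∈ upperHalf, ‖G z w‖ ≤ 1 := by
    filter_upwards [ae_unif_mem_prod] with w hw z hz
    obtain ⟨p1, p2, p3, p4⟩ := hpos w hw
    simp only [hG, norm_mul]
    have q1 := hΦ1 _ (ofReal_mul_mem_upperHalf hz p1)
    have q2 := hΦ1 _ (ofReal_mul_mem_upperHalf hz p2)
    have q3 := hΦ1' _ (ofReal_mul_mem_upperHalf hz p3)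
    have q4 := hΦ1' _ (ofReal_mul_mem_upperHalf hz p4)
    exact mul_le_one₀ (mul_le_one₀ (mul_le_one₀ q1 (norm_nonneg _) q2) (norm_nonneg _) q3)
      (norm_nonneg _) q4
  refine ⟨fun z => ∫ w, G z w ∂unif.prod unif,
    differentiableOn_integral_of_norm_le isOpen_upperHalf hGm hGd hGb, fun z hz => ?_,
    fun p hp => ?_⟩
  · have := norm_integral_le_of_norm_le_const (hGb.mono fun w hw => hw z hz)
    simpa using this
  · have hmem : ∀ y : ℝ, 0 < y → (p + y * Complex.I : ℂ) ∈ upperHalf := fun y hy => by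
      simpa [upperHalf] using hy
    -- Back to `φ` itself, since the limits of `Φ` are stated in terms of `φ`.
    have hK : phiTilde φ p = ∫ w, kernel φ p w ∂unif.prod unif := by
      rw [phiTilde_eq_integral he hm h1 hp, integral_congr_ae (kernel_ae_eq he hp)]
    rw [hK]
    refine tendsto_integral_filter_of_dominated_convergence (fun _ => 1) ?_ ?_
      (integrable_const _) ?_
    · filter_upwards [self_mem_nhdsWithin] with y hy using hGm _ (hmem y hy)
    · filter_upwards [self_mem_nhdsWithin] with y hy
      exact hGb.mono fun w hw => hw _ (hmem y hy)
    · have hscale : ∀ {a : ℝ}, 0 < a → Tendsto (fun y : ℝ => y * a) (𝓝[>] 0) (𝓝[>] 0) := by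
        intro a ha
        refine tendsto_nhdsWithin_iff.2 ⟨?_, ?_⟩
        · have : Continuous fun y : ℝ => y * a := by fun_prop
          exact (this.tendsto' 0 0 (by simp)).mono_left nhdsWithin_le_nhds
        · filter_upwards [self_mem_nhdsWithin] with y hy using mul_pos hy ha
      have t1 : ∀ {a : ℝ}, 0 < a →
          Tendsto (fun y : ℝ => Φ (((p * a : ℝ) : ℂ) + y * Complex.I)) (𝓝[>] 0)
            (𝓝 (φ (p * a))) →
          Tendsto (fun y : ℝ => Φ ((p + y * Complex.I) * (a : ℂ))) (𝓝[>] 0)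
            (𝓝 (φ (p * a))) := by
        intro a ha ht
        refine (ht.comp (hscale ha)).congr fun y => ?_
        simp only [Function.comp_apply]
        congr 1; push_cast; ring
      -- Here `-conj((p + iy)a) = -pa + iya`: the reflected point approaches `-pa` vertically from
      -- above.
      have t2 : ∀ {a : ℝ}, 0 < a →
          Tendsto (fun y : ℝ => Φ (((-(p * a) : ℝ) : ℂ) + y * Complex.I)) (𝓝[>] 0)
            (𝓝 (φ (-(p * a)))) →
          Tendsto (fun y : ℝ => checkExt Φ ((p + y * Complex.I) * (a : ℂ))) (𝓝[>] 0)
            (𝓝 (check φ (p * a))) := by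
        intro a ha ht
        refine (Complex.continuous_conj.tendsto _).comp ((ht.comp (hscale ha)).congr fun y => ?_)
        simp only [Function.comp_apply]
        congr 1
        simp only [map_mul, map_add, Complex.conj_ofReal, Complex.conj_I]
        push_cast; ring
      filter_upwards [ae_unif_mem_prod, ae_unif_mul_all hb hp, ae_unif_mul_all (ae_neg hb) hp]
        with w hw b1 b2
      obtain ⟨p1, p2, p3, p4⟩ := hpos w hw
      exact (((t1 p1 b1.1).mul (t1 p2 b1.2.1)).mul (t2 p3 b2.2.2.1)).mul (t2 p4 b2.2.2.2)

/-! ### The spectral measure of multiplication operators -/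

section Multiplication

variable {α : Type*} [MeasurableSpace α] {μ : Measure α}

theorem inner_mulOp (g : α → ℂ) (hg : MemLp g ∞ μ) (x y : Lp ℂ 2 μ) :
    inner ℂ x (mulOp g hg y) = ∫ a, g a * ((starRingEnd ℂ) (x a) * y a) ∂μ := by
  rw [L2.inner_def]
  refine integral_congr_ae ?_
  filter_upwards [coeFn_mulOp g hg y] with a ha
  rw [RCLike.inner_apply, ha]; ring

theorem ofReal_norm_sq (x : Lp ℂ 2 μ) : ENNReal.ofReal (‖x‖ ^ 2) = ∫⁻ a, ‖x a‖ₑ ^ 2 ∂μ := by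
  rw [ENNReal.ofReal_pow (norm_nonneg _), ofReal_norm, Lp.enorm_def]
  have h := eLpNorm_nnreal_pow_eq_lintegral (μ := μ) (f := x) (p := 2) two_ne_zero
  simpa using h

/-- The measure `|x|² μ`. -/
noncomputable def densityMeasure (x : Lp ℂ 2 μ) : Measure α := μ.withDensity fun a => ‖x a‖ₑ ^ 2

instance (x : Lp ℂ 2 μ) : IsFiniteMeasure (densityMeasure x) :=
  isFiniteMeasure_withDensity (by rw [← ofReal_norm_sq]; exact ENNReal.ofReal_ne_top)

theorem memLp_indicator_one {s : Set α} (hs : MeasurableSet s) :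
    MemLp (s.indicator fun _ => (1 : ℂ)) ∞ μ :=
  (memLp_top_const (1 : ℂ)).indicator hs

open Classical in
/-- Multiplication by the indicator function of a measurable set. -/
noncomputable def indicatorOp (μ : Measure α) (s : Set α) : Lp ℂ 2 μ →L[ℂ] Lp ℂ 2 μ :=
  -- The value `0` on non-measurable sets is arbitrary; `SpectralMeasure` constrains only measurable
  -- ones.
  if hs : MeasurableSet s then mulOp (s.indicator fun _ => 1) (memLp_indicator_one hs) else 0

theorem coeFn_indicatorOp {s : Set α} (hs : MeasurableSet s) (x : Lp ℂ 2 μ) :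
    indicatorOp μ s x =ᵐ[μ] s.indicator x := by
  rw [indicatorOp, dif_pos hs]
  filter_upwards [coeFn_mulOp _ (memLp_indicator_one hs) x] with a ha
  rw [ha]
  by_cases h : a ∈ s <;> simp [h]

theorem ofReal_norm_sq_indicatorOp {s : Set α} (hs : MeasurableSet s) (x : Lp ℂ 2 μ) :
    ENNReal.ofReal (‖indicatorOp μ s x‖ ^ 2) = densityMeasure x s := by
  rw [ofReal_norm_sq, densityMeasure, withDensity_apply _ hs, ← lintegral_indicator hs]
  refine lintegral_congr_ae ?_
  filter_upwards [coeFn_indicatorOp hs x] with a ha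
  rw [ha]
  by_cases h : a ∈ s <;> simp [h]

theorem indicatorOp_univ : indicatorOp μ Set.univ = 1 := by
  ext1 x
  apply Lp.ext
  filter_upwards [coeFn_indicatorOp MeasurableSet.univ x] with a ha
  rw [ha]; simp

theorem isStarProjection_indicatorOp {s : Set α} (hs : MeasurableSet s) :
    IsStarProjection (indicatorOp μ s) := by
  refine ⟨?_, ?_⟩
  · refine ContinuousLinearMap.ext fun x => Lp.ext ?_
    change indicatorOp μ s (indicatorOp μ s x) =ᵐ[μ] _
    filter_upwards [coeFn_indicatorOp hs (indicatorOp μ s x), coeFn_indicatorOp hs x] with a h1 h2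
    rw [h1]
    by_cases h : a ∈ s
    · simp [h]
    · rw [h2]; simp [h]
  · rw [ContinuousLinearMap.isSelfAdjoint_iff_isSymmetric]
    intro x y
    change inner ℂ (indicatorOp μ s x) y = inner ℂ x (indicatorOp μ s y)
    rw [L2.inner_def, L2.inner_def]
    refine integral_congr_ae ?_
    filter_upwards [coeFn_indicatorOp hs x, coeFn_indicatorOp hs y] with a h1 h2
    rw [h1, h2]
    by_cases h : a ∈ s <;> simp [h]

theorem indicatorOp_sub {s t : Set α} (hs : MeasurableSet s) (ht : MeasurableSet t) (hst : t ⊆ s)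
    (x : Lp ℂ 2 μ) :
    indicatorOp μ s x - indicatorOp μ t x = indicatorOp μ (s \ t) x := by
  apply Lp.ext
  filter_upwards [Lp.coeFn_sub (indicatorOp μ s x) (indicatorOp μ t x), coeFn_indicatorOp hs x,
    coeFn_indicatorOp ht x, coeFn_indicatorOp (hs.diff ht) x] with a h1 h2 h3 h4
  rw [h1, Pi.sub_apply, h2, h3, h4]
  by_cases h : a ∈ t
  · simp [h, hst h]
  · by_cases h' : a ∈ s <;> simp [h, h']

theorem sum_indicatorOp {s : ℕ → Set α} (hs : ∀ n, MeasurableSet (s n))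
    (hd : Pairwise (Function.onFun Disjoint s)) (F : Finset ℕ) (x : Lp ℂ 2 μ) :
    ∑ n ∈ F, indicatorOp μ (s n) x = indicatorOp μ (⋃ n ∈ F, s n) x := by
  classical
  induction F using Finset.induction_on with
  | empty =>
    rw [Finset.sum_empty]
    apply Lp.ext
    filter_upwards [coeFn_indicatorOp (μ := μ) (s := ⋃ n ∈ (∅ : Finset ℕ), s n) (by simp) x,
      Lp.coeFn_zero ℂ 2 μ] with a h1 h2
    rw [h1, h2]; simp
  | insert m F hm ih =>
    have hF : MeasurableSet (⋃ n ∈ F, s n) := F.measurableSet_biUnion fun n _ => hs n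
    have hF' : MeasurableSet (⋃ n ∈ insert m F, s n) :=
      (insert m F).measurableSet_biUnion fun n _ => hs n
    have hsub : (⋃ n ∈ F, s n) ⊆ ⋃ n ∈ insert m F, s n := by
      rw [Finset.set_biUnion_insert]; exact Set.subset_union_right
    have hdiff : (⋃ n ∈ insert m F, s n) \ (⋃ n ∈ F, s n) = s m := by
      rw [Finset.set_biUnion_insert, Set.union_sdiff_right]
      refine Disjoint.sdiff_eq_left ?_
      simp only [Set.disjoint_iUnion_right]
      intro n hn
      exact hd fun e => hm (e ▸ hn)
    rw [Finset.sum_insert hm, ih, ← hdiff, ← indicatorOp_sub hF' hF hsub, sub_add_cancel]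

/-- The squared norm of the remainder of a partial sum is the `densityMeasure x`-mass of the sets
not yet included, so strong convergence is countable additivity of the finite measure `|x|² μ`. -/
theorem hasSum_indicatorOp {s : ℕ → Set α} (hs : ∀ n, MeasurableSet (s n))
    (hd : Pairwise (Function.onFun Disjoint s)) (x : Lp ℂ 2 μ) :
    HasSum (fun n => indicatorOp μ (s n) x) (indicatorOp μ (⋃ n, s n) x) := by
  have hU := MeasurableSet.iUnion hs
  rw [HasSum, tendsto_iff_norm_sub_tendsto_zero]
  have hF : ∀ F : Finset ℕ, MeasurableSet (⋃ n ∈ F, s n) := fun F =>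
    F.measurableSet_biUnion fun n _ => hs n
  have key : ∀ F : Finset ℕ, ‖∑ n ∈ F, indicatorOp μ (s n) x - indicatorOp μ (⋃ n, s n) x‖ ^ 2 =
      (densityMeasure x (⋃ n, s n)).toReal - ∑ n ∈ F, (densityMeasure x (s n)).toReal := by
    intro F
    have hsub : (⋃ n ∈ F, s n) ⊆ ⋃ n, s n := Set.iUnion₂_subset_iUnion _ _
    rw [norm_sub_rev, sum_indicatorOp hs hd, indicatorOp_sub hU (hF F) hsub,
      ← ENNReal.toReal_ofReal (sq_nonneg ‖_‖), ofReal_norm_sq_indicatorOp (hU.diff (hF F)),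
      measure_sdiff hsub (hF F).nullMeasurableSet (measure_ne_top _ _),
      ENNReal.toReal_sub_of_le (measure_mono hsub) (measure_ne_top _ _),
      measure_biUnion_finset (fun i _ j _ hij => hd hij) (fun n _ => hs n),
      ENNReal.toReal_sum fun n _ => measure_ne_top _ _]
  have hsum : HasSum (fun n => (densityMeasure x (s n)).toReal)
      (densityMeasure x (⋃ n, s n)).toReal := by
    rw [measure_iUnion hd hs]
    have hne : ∑' n, densityMeasure x (s n) ≠ ∞ := by
      rw [← measure_iUnion hd hs]; exact measure_ne_top _ _
    rw [ENNReal.tsum_toReal_eq fun n => measure_ne_top _ _]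
    exact (ENNReal.summable_toReal hne).hasSum
  have h2 := (tendsto_const_nhds (x := (densityMeasure x (⋃ n, s n)).toReal)).sub hsum
  rw [sub_self] at h2
  have h3 := (h2.congr fun F => (key F).symm).sqrt
  simpa [Real.sqrt_sq (norm_nonneg _)] using h3

/-- The spectral measure on `L²(μ)` given by multiplication by indicator functions. -/
noncomputable def indicatorMeasure (μ : Measure α) : SpectralMeasure α (Lp ℂ 2 μ) where
  proj := indicatorOp μ
  isStarProjection _ hs := isStarProjection_indicatorOp hs
  proj_univ := indicatorOp_univ
  hasSum _ hs hd x := hasSum_indicatorOp hs hd x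

theorem indicatorMeasure_measure (x : Lp ℂ 2 μ) :
    (indicatorMeasure μ).measure x = densityMeasure x := by
  ext s hs
  rw [SpectralMeasure.measure, Measure.ofMeasurable_apply s hs]
  exact ofReal_norm_sq_indicatorOp hs x

/-- The scalar spectral measure of `x` is `|x|² μ`. It is finite and absolutely continuous with
respect to `μ`, so an essentially bounded `g` is integrable, and `∫ g |x|² dμ` is the quadratic form
of multiplication by `g`. -/
theorem isIntegral_mulOp (g : α → ℂ) (hg : MemLp g ∞ μ) :
    (indicatorMeasure μ).IsIntegral g (mulOp g hg) := by
  intro x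
  rw [indicatorMeasure_measure]
  have hac : densityMeasure x ≪ μ := withDensity_absolutelyContinuous _ _
  refine ⟨?_, ?_⟩
  · obtain ⟨C, hC⟩ : ∃ C : ℝ, ∀ᵐ a ∂μ, ‖g a‖ ≤ C := ⟨_, ae_le_lpNorm_exponent_top hg⟩
    exact Integrable.of_bound (hg.1.mono_ac hac) C (hac.ae_le hC)
  · have hm : Measurable fun a => ‖x a‖₊ ^ 2 :=
      (Lp.stronglyMeasurable x).measurable.nnnorm.pow_const 2
    have h := integral_withDensity_eq_integral_smul (μ := μ) hm g
    rw [inner_mulOp]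
    refine Eq.trans ?_ h.symm
    refine integral_congr_ae (Eventually.of_forall fun a => ?_)
    simp only [NNReal.smul_def, NNReal.coe_pow, coe_nnnorm, Complex.real_smul]
    rw [← Complex.normSq_eq_conj_mul_self, Complex.normSq_eq_norm_sq, mul_comm]

end Multiplication

/-! ### Image spectral measures -/

theorem SpectralMeasure.measure_map {X Y H : Type*} [MeasurableSpace X] [MeasurableSpace Y]
    [NormedAddCommGroup H] [InnerProductSpace ℂ H] [CompleteSpace H] (E : SpectralMeasure X H)
    {f : X → Y} (hf : Measurable f) (x : H) :
    (E.map f hf).measure x = (E.measure x).map f := by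
  ext s hs
  rw [Measure.map_apply hf hs, SpectralMeasure.measure, SpectralMeasure.measure,
    Measure.ofMeasurable_apply s hs, Measure.ofMeasurable_apply _ (hf hs)]
  rfl

theorem SpectralMeasure.IsIntegral.map {X Y H : Type*} [MeasurableSpace X] [MeasurableSpace Y]
    [NormedAddCommGroup H] [InnerProductSpace ℂ H] [CompleteSpace H] {E : SpectralMeasure X H}
    {f : X → Y} (hf : Measurable f) {g : Y → ℂ} (hg : Measurable g) {T : H →L[ℂ] H}
    (h : E.IsIntegral (fun x => g (f x)) T) : (E.map f hf).IsIntegral g T := by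
  intro x
  rw [E.measure_map hf]
  exact ⟨(integrable_map_measure hg.aestronglyMeasurable hf.aemeasurable).2 (h x).1,
    (h x).2.trans (integral_map hf.aemeasurable hg.aestronglyMeasurable).symm⟩

/-! ### Momentum on the bosonic space -/

theorem coeFn_embed (Ψ : BosePair) : ((embed Ψ : FermiFock) : UFock) =ᵐ[configMeasure] embedFun Ψ :=
  (memLp_embedFun Ψ).coeFn_toLp

theorem coeFn_fermiMul (g : Config → ℂ) (hg : MemLp g ∞ configMeasure)
    (hs : ∀ σ τ z, g (permute σ τ z) = g z) (F : FermiFock) :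
    ((fermiMul g hg hs F : FermiFock) : UFock) =ᵐ[configMeasure] fun z => g z * (F : UFock) z :=
  coeFn_mulOp g hg F

theorem embedFun_of_ne (Ψ : ℝ × ℝ → ℂ) {k : ℕ × ℕ} (hk : k ≠ (2, 2))
    (x : (Fin k.1 → Mode) × (Fin k.2 → Mode)) : embedFun Ψ ⟨k, x⟩ = 0 := by
  unfold embedFun
  split
  · rename_i h; cases h; exact absurd rfl hk
  · rfl

theorem memLp_phase (s t : ℝ) : MemLp (fun w : ℝ × ℝ =>
    Complex.exp (Complex.I * ((s * w.1 + t * w.2 : ℝ) : ℂ))) ∞ (boseMeasure.prod boseMeasure) := by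
  refine memLp_top_of_bound (Measurable.aestronglyMeasurable (by fun_prop)) 1
    (Eventually.of_forall fun w => ?_)
  rw [mul_comm, Complex.norm_exp_ofReal_mul_I]

/-- In the sector of two modes on each side the phase depends only on the two total momenta, which
are exactly the arguments of `Ψ` in `embedFun`. -/
theorem translation_embed (s t : ℝ) (Ψ : BosePair) :
    translation s t (embed Ψ) = embed (mulOp _ (memLp_phase s t) Ψ) := by
  refine Subtype.ext (Lp.ext ?_)
  have hm : Measurable fun w : ℝ × ℝ =>
      Complex.exp (Complex.I * ((s * w.1 + t * w.2 : ℝ) : ℂ)) * Ψ w :=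
    Measurable.mul (by fun_prop) (Lp.stronglyMeasurable Ψ).measurable
  filter_upwards [coeFn_fermiMul (translationPhase s t) (memLp_translationPhase s t)
    (translationPhase_permute s t) (embed Ψ), coeFn_embed Ψ,
    coeFn_embed (mulOp _ (memLp_phase s t) Ψ),
    embedFun_congr (Lp.stronglyMeasurable (mulOp _ (memLp_phase s t) Ψ)).measurable hm
      (coeFn_mulOp _ (memLp_phase s t) Ψ)] with z h1 h2 h3 h4
  rw [translation, h1, h2, h3, h4]
  obtain ⟨k, x⟩ := z
  by_cases hk : k = (2, 2)
  · subst hk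
    simp only [embedFun, translationPhase, Fin.sum_univ_two]
    ring
  · rw [embedFun_of_ne _ hk, embedFun_of_ne _ hk, mul_zero]

theorem isJointMomentumMeasure_indicatorMeasure :
    IsJointMomentumMeasure (indicatorMeasure (boseMeasure.prod boseMeasure)) := fun s t =>
  ⟨mulOp _ (memLp_phase s t), translation_embed s t, isIntegral_mulOp _ _⟩

theorem memLp_phiTilde_mul {φ : ℝ → ℂ} (h : IsInner φ) :
    MemLp (fun w : ℝ × ℝ => phiTilde φ (w.1 * w.2)) ∞ (boseMeasure.prod boseMeasure) :=
  memLp_top_of_bound ((measurable_phiTilde h).comp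
    (measurable_fst.mul measurable_snd)).aestronglyMeasurable 1
    (Eventually.of_forall fun _ => norm_phiTilde_le h _)

theorem isFunctionOfMomentumProduct_mulOp {φ : ℝ → ℂ} (h : IsInner φ) :
    IsFunctionOfMomentumProduct (phiTilde φ) (mulOp _ (memLp_phiTilde_mul h)) :=
  ⟨_, isJointMomentumMeasure_indicatorMeasure,
    (isIntegral_mulOp _ (memLp_phiTilde_mul h)).map _ (measurable_phiTilde h)⟩

/-! ### Total momentum and momentum fraction of a pair of fermions -/

/-- The total momentum of two modes, and the fraction of it carried by the first `+` fermion (by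
the second mode, if the first one is a `-` fermion). -/
noncomputable def pairMap (x : Fin 2 → Mode) : ℝ × ℝ :=
  ((x 0).1 + (x 1).1,
    if (x 0).2 = true then (x 0).1 / ((x 0).1 + (x 1).1) else (x 1).1 / ((x 0).1 + (x 1).1))

theorem measurable_pairMap : Measurable pairMap := by
  unfold pairMap
  refine Measurable.prodMk (by fun_prop) (Measurable.ite ?_ (by fun_prop) (by fun_prop))
  exact measurableSet_eq_fun (f := fun x : Fin 2 → Mode => (x 0).2) (by fun_prop) measurable_const

theorem lintegral_Ioo_div {f : ℝ → ℝ≥0∞} (hf : Measurable f) {s : ℝ} (hs : 0 < s) :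
    ∫⁻ p in Set.Ioo 0 s, f (p / s) = ENNReal.ofReal s * ∫⁻ u, f u ∂unif := by
  have hm : Measurable ((Set.Ioo 0 s).indicator fun p => f (p / s)) :=
    (hf.comp (measurable_id.div_const s)).indicator measurableSet_Ioo
  rw [← lintegral_indicator measurableSet_Ioo]
  conv_lhs => rw [← Real.smul_map_volume_mul_left hs.ne', abs_of_pos hs]
  rw [lintegral_smul_measure, smul_eq_mul, lintegral_map hm (by fun_prop), unif,
    ← lintegral_indicator measurableSet_Ioo]
  congr 1
  refine lintegral_congr fun u => ?_
  have : s * u ∈ Set.Ioo 0 s ↔ u ∈ Set.Ioo (0 : ℝ) 1 := by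
    rw [Set.mem_Ioo, Set.mem_Ioo, mul_pos_iff_of_pos_left hs, mul_lt_iff_lt_one_right hs]
  by_cases hu : u ∈ Set.Ioo (0 : ℝ) 1
  · rw [Set.indicator_of_mem (this.2 hu), Set.indicator_of_mem hu, mul_div_cancel_left₀ _ hs.ne']
  · rw [Set.indicator_of_notMem (mt this.1 hu), Set.indicator_of_notMem hu]

/-- Put `s = p + q` for fixed `p`, exchange the integrals, and put `p = su` with `0 < u < 1` for
fixed `s`. The Jacobian `s` is the density of `boseMeasure`. -/
theorem lintegral_momentum_fraction {h : ℝ × ℝ → ℝ≥0∞} (hh : Measurable h) :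
    ∫⁻ p in Set.Ioi (0 : ℝ), ∫⁻ q in Set.Ioi (0 : ℝ), h (p + q, p / (p + q)) =
      ∫⁻ w, h w ∂boseMeasure.prod unif := by
  have hi : Measurable fun w : ℝ × ℝ => (Set.Ioi w.1).indicator (fun s => h (s, w.1 / s)) w.2 := by
    have : (fun w : ℝ × ℝ => (Set.Ioi w.1).indicator (fun s => h (s, w.1 / s)) w.2) =
        Set.indicator {w : ℝ × ℝ | w.1 < w.2} (fun w => h (w.2, w.1 / w.2)) := by
      ext w; simp [Set.indicator]
    rw [this]
    exact (hh.comp (by fun_prop)).indicator (measurableSet_lt measurable_fst measurable_snd)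
  have h1 : ∀ p : ℝ, ∫⁻ q in Set.Ioi (0 : ℝ), h (p + q, p / (p + q)) =
      ∫⁻ s, (Set.Ioi p).indicator (fun s => h (s, p / s)) s := by
    intro p
    rw [← lintegral_indicator measurableSet_Ioi,
      ← lintegral_add_left_eq_self (fun s => (Set.Ioi p).indicator (fun s => h (s, p / s)) s) p]
    refine lintegral_congr fun q => ?_
    simp [Set.indicator]
  simp_rw [h1]
  have hin : Measurable fun s : ℝ => ∫⁻ u, h (s, u) ∂unif := hh.lintegral_prod_right'
  rw [lintegral_lintegral_swap (f := fun p s => (Set.Ioi p).indicator (fun s => h (s, p / s)) s)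
    hi.aemeasurable, lintegral_prod _ hh.aemeasurable, boseMeasure,
    lintegral_withDensity_eq_lintegral_mul _ (by fun_prop) hin,
    ← lintegral_indicator measurableSet_Ioi]
  refine lintegral_congr fun s => ?_
  have h2 : ∀ p : ℝ, (Set.Ioi p).indicator (fun s => h (s, p / s)) s =
      (Set.Iio s).indicator (fun p => h (s, p / s)) p := by
    intro p; simp [Set.indicator]
  simp_rw [h2]
  rw [lintegral_indicator measurableSet_Iio, Measure.restrict_restrict measurableSet_Iio,
    Set.Iio_inter_Ioi]
  by_cases hs : 0 < s
  · rw [lintegral_Ioo_div (f := fun u => h (s, u)) (hh.comp (by fun_prop)) hs]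
    simp [hs]
  · simp [hs]

/-- Normalized squared modulus of `chargeCoeff`. -/
noncomputable def chargeDensity (x : Fin 2 → Mode) : NNReal :=
  (Real.toNNReal (2 * Real.pi)⁻¹) ^ 2 * ‖chargeCoeff x‖₊ ^ 2

theorem measurable_chargeDensity : Measurable chargeDensity :=
  (measurable_chargeCoeff.nnnorm.pow_const 2).const_mul _

/-- The two-mode measure weighted by `chargeDensity`. -/
noncomputable def chargeMeasure : Measure (Fin 2 → Mode) :=
  (Measure.pi fun _ => modeMeasure).withDensity fun x => (chargeDensity x : ℝ≥0∞)

instance : SFinite chargeMeasure := by unfold chargeMeasure; infer_instance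

/-- Each order of the charges `(+,-)` and `(-,+)` has squared weight `1/2` and gives the same
integral, the second after exchanging `p` and `q`; equal charges contribute nothing. Each mode
supplies one factor `2π`. -/
theorem lintegral_chargeCoeff_pairMap {h : ℝ × ℝ → ℝ≥0∞} (hh : Measurable h) :
    ∫⁻ x, ‖chargeCoeff x‖ₑ ^ 2 * h (pairMap x) ∂(Measure.pi fun _ => modeMeasure) =
      ENNReal.ofReal (2 * Real.pi) ^ 2 * ∫⁻ w, h w ∂boseMeasure.prod unif := by
  have hpair : Measurable fun w : Mode × Mode => (![w.1, w.2] : Fin 2 → Mode) := by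
    refine measurable_pi_lambda _ fun i => ?_
    fin_cases i
    · exact measurable_fst
    · exact measurable_snd
  obtain ⟨G, hG⟩ : ∃ G : Mode × Mode → ℝ≥0∞, ∀ a b, G (a, b) =
      ‖chargeCoeff ![a, b]‖ₑ ^ 2 * h (pairMap ![a, b]) :=
    ⟨fun w => ‖chargeCoeff ![w.1, w.2]‖ₑ ^ 2 * h (pairMap ![w.1, w.2]), fun _ _ => rfl⟩
  have hm : Measurable G := by
    have : G = fun w => ‖chargeCoeff ![w.1, w.2]‖ₑ ^ 2 * h (pairMap ![w.1, w.2]) := by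
      ext w; exact hG w.1 w.2
    rw [this]
    exact ((measurable_chargeCoeff.comp hpair).enorm.pow_const 2).mul
      (hh.comp (measurable_pairMap.comp hpair))
  have h0 := (measurePreserving_finTwoArrow modeMeasure).lintegral_comp hm
  have e0 : ∀ x : Fin 2 → Mode, G (MeasurableEquiv.finTwoArrow x) =
      ‖chargeCoeff x‖ₑ ^ 2 * h (pairMap x) := by
    intro x
    have e1 : ![x 0, x 1] = x := by ext i <;> fin_cases i <;> rfl
    have e2 := hG (x 0) (x 1)
    rw [e1] at e2
    exact e2
  simp_rw [e0] at h0
  refine h0.trans ?_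
  have half : ENNReal.ofReal ((1 / Real.sqrt 2) ^ 2) = 2⁻¹ := by
    rw [div_pow, Real.sq_sqrt (by norm_num), one_pow, one_div,
      ENNReal.ofReal_inv_of_pos (by norm_num)]
    simp
  have en : ∀ r : ℝ, ‖(r : ℂ)‖ₑ ^ 2 = ENNReal.ofReal (r ^ 2) := by
    intro r
    rw [← ofReal_norm, Complex.norm_real, ← ENNReal.ofReal_pow (norm_nonneg _),
      Real.norm_eq_abs, sq_abs]
  rw [lintegral_prod _ hm.aemeasurable, lintegral_modeMeasure (Measurable.lintegral_prod_right' hm)]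
  have hA : Measurable fun w : ℝ × ℝ => h (w.1 + w.2, w.1 / (w.1 + w.2)) :=
    hh.comp (by fun_prop)
  have hB : Measurable fun w : ℝ × ℝ => h (w.1 + w.2, w.2 / (w.1 + w.2)) :=
    hh.comp (by fun_prop)
  have hst : ∀ p : ℝ, ∫⁻ b, G ((p, true), b) ∂modeMeasure =
      ENNReal.ofReal (2 * Real.pi) * 2⁻¹ *
        ∫⁻ q in Set.Ioi (0 : ℝ), h (p + q, p / (p + q)) := by
    intro p
    have hmp : Measurable fun b : Mode => G ((p, true), b) := hm.comp (by fun_prop)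
    rw [lintegral_modeMeasure hmp, mul_assoc, ← lintegral_const_mul _
      (show Measurable fun q : ℝ => h (p + q, p / (p + q)) from
        hA.comp (measurable_const.prodMk measurable_id))]
    congr 1
    refine lintegral_congr fun q => ?_
    rw [hG, hG]
    simp only [pairMap, chargeCoeff, Matrix.cons_val_zero, Matrix.cons_val_one, Bool.true_eq_false,
      false_and, if_false, true_and, if_true, en, half, enorm_zero]
    simp
  have hsf : ∀ p : ℝ, ∫⁻ b, G ((p, false), b) ∂modeMeasure =
      ENNReal.ofReal (2 * Real.pi) * 2⁻¹ *
        ∫⁻ q in Set.Ioi (0 : ℝ), h (p + q, q / (p + q)) := by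
    intro p
    have hmp : Measurable fun b : Mode => G ((p, false), b) := hm.comp (by fun_prop)
    rw [lintegral_modeMeasure hmp, mul_assoc, ← lintegral_const_mul _
      (show Measurable fun q : ℝ => h (p + q, q / (p + q)) from
        hB.comp (measurable_const.prodMk measurable_id))]
    congr 1
    refine lintegral_congr fun q => ?_
    rw [hG, hG]
    simp only [pairMap, chargeCoeff, Matrix.cons_val_zero, Matrix.cons_val_one, Bool.false_eq_true,
      false_and, if_false, true_and, if_true, en, neg_sq, half, and_false, enorm_zero]
    simp
  simp only [hst, hsf]
  have hA' : Measurable fun p : ℝ => ∫⁻ q in Set.Ioi (0 : ℝ), h (p + q, p / (p + q)) :=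
    hA.lintegral_prod_right'
  have hB' : Measurable fun p : ℝ => ∫⁻ q in Set.Ioi (0 : ℝ), h (p + q, q / (p + q)) :=
    hB.lintegral_prod_right'
  have eB : ∫⁻ p in Set.Ioi (0 : ℝ), ∫⁻ q in Set.Ioi (0 : ℝ), h (p + q, q / (p + q)) =
      ∫⁻ w, h w ∂boseMeasure.prod unif := by
    rw [lintegral_lintegral_swap (f := fun p q => h (p + q, q / (p + q))) hB.aemeasurable,
      ← lintegral_momentum_fraction hh]
    simp_rw [add_comm]
  rw [lintegral_add_left (hA'.const_mul _), lintegral_const_mul _ hA', lintegral_const_mul _ hB',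
    lintegral_momentum_fraction hh, eB, ← add_mul, ← mul_add, ENNReal.inv_two_add_inv_two, mul_one,
    sq, mul_assoc]

/-- The normalization of `chargeDensity` cancels the `(2π)²` of the two modes. The momentum fraction
thus becomes uniform on `(0, 1)` and independent of the total momentum, which is why the compression
is a plain average. -/
theorem measurePreserving_pairMap :
    MeasurePreserving pairMap chargeMeasure (boseMeasure.prod unif) := by
  refine ⟨measurable_pairMap, Measure.ext_of_lintegral _ fun h hh => ?_⟩
  have hd : Measurable fun x => (chargeDensity x : ℝ≥0∞) :=
    measurable_chargeDensity.coe_nnreal_ennreal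
  have hm : Measurable fun x => ‖chargeCoeff x‖ₑ ^ 2 * h (pairMap x) :=
    (measurable_chargeCoeff.enorm.pow_const 2).mul (hh.comp measurable_pairMap)
  rw [lintegral_map hh measurable_pairMap, chargeMeasure,
    lintegral_withDensity_eq_lintegral_mul _ hd
      (show Measurable fun x => h (pairMap x) from hh.comp measurable_pairMap)]
  set c : ℝ≥0∞ := ENNReal.ofReal (2 * Real.pi) with hc
  have hc0 : c ≠ 0 := by rw [hc]; simp [Real.pi_pos]
  have hct : c ≠ ∞ := ENNReal.ofReal_ne_top
  have e : ∀ x, ((fun x => (chargeDensity x : ℝ≥0∞)) * fun x => h (pairMap x)) x =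
      c⁻¹ ^ 2 * (‖chargeCoeff x‖ₑ ^ 2 * h (pairMap x)) := by
    intro x
    have : ((Real.toNNReal (2 * Real.pi)⁻¹ : NNReal) : ℝ≥0∞) = c⁻¹ :=
      ENNReal.ofReal_inv_of_pos (by positivity)
    rw [Pi.mul_apply, chargeDensity, ENNReal.coe_mul, ENNReal.coe_pow, ENNReal.coe_pow, this,
      mul_assoc]
    rfl
  change ∫⁻ x, ((fun x => (chargeDensity x : ℝ≥0∞)) * fun x => h (pairMap x)) x ∂_ = _
  simp_rw [e]
  rw [lintegral_const_mul _ hm, lintegral_chargeCoeff_pairMap hh, ← mul_assoc, ← mul_pow,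
    ENNReal.inv_mul_cancel hc0 hct, one_pow, one_mul]

/-- Exchange of the two middle factors of a product of four measure spaces. -/
theorem measurePreserving_prodProdProdComm {A B C D : Type*} [MeasurableSpace A]
    [MeasurableSpace B] [MeasurableSpace C] [MeasurableSpace D] (a : Measure A) (b : Measure B)
    (c : Measure C) (d : Measure D) [SFinite a] [SFinite b] [SFinite c] [SFinite d] :
    MeasurePreserving (fun w : (A × B) × C × D => ((w.1.1, w.2.1), w.1.2, w.2.2))
      ((a.prod b).prod (c.prod d)) ((a.prod c).prod (b.prod d)) := by
  have h1 := measurePreserving_prodAssoc a b (c.prod d)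
  have h2 := (MeasurePreserving.id a).prod ((measurePreserving_prodAssoc b c d).symm)
  have h3 := (MeasurePreserving.id a).prod
    ((Measure.measurePreserving_swap (μ := b) (ν := c)).prod (MeasurePreserving.id d))
  have h4 := (MeasurePreserving.id a).prod (measurePreserving_prodAssoc c b d)
  have h5 := (measurePreserving_prodAssoc a c (b.prod d)).symm
  exact h5.comp (h4.comp (h3.comp (h2.comp h1)))

theorem prod_chargeMeasure : chargeMeasure.prod chargeMeasure =
    (sectorMeasure (2, 2)).withDensity
      fun x => ((chargeDensity x.1 * chargeDensity x.2 : NNReal) : ℝ≥0∞) := by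
  rw [chargeMeasure, prod_withDensity measurable_chargeDensity.coe_nnreal_ennreal
    measurable_chargeDensity.coe_nnreal_ennreal, sectorMeasure]
  simp_rw [ENNReal.coe_mul]

/-! ### Compression of the scattering operator -/

theorem restrict_configMeasure (k : ℕ × ℕ) :
    configMeasure.restrict {z | z.1 = k} = (sectorMeasure k).map (Sigma.mk k) := by
  have hk : MeasurableSet {z : Config | z.1 = k} := measurableSet_config fun k' => by
    by_cases h : k' = k
    · simp [h]
    · simp [h]
  ext s hs
  rw [Measure.restrict_apply hs, configMeasure, Measure.sum_apply _ (hs.inter hk),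
    tsum_eq_single k]
  · rw [Measure.map_apply (measurable_sigmaMk k) (hs.inter hk),
      Measure.map_apply (measurable_sigmaMk k) hs]
    congr 1
    ext x; simp
  · intro k' hk'
    rw [Measure.map_apply (measurable_sigmaMk k') (hs.inter hk)]
    convert measure_empty (μ := sectorMeasure k')
    ext x; simp [hk']

theorem integral_config_eq_sector {f : Config → ℂ} (hf : Measurable f) {k : ℕ × ℕ}
    (h0 : ∀ z : Config, z.1 ≠ k → f z = 0) :
    ∫ z, f z ∂configMeasure = ∫ x, f ⟨k, x⟩ ∂sectorMeasure k := by
  rw [← setIntegral_eq_integral_of_forall_compl_eq_zero (s := {z : Config | z.1 = k}) h0,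
    restrict_configMeasure, integral_map (measurable_sigmaMk k).aemeasurable
      hf.aestronglyMeasurable]

theorem ae_modeMeasure_pos : ∀ᵐ a ∂modeMeasure, 0 < a.1 := by
  have : ∀ᵐ p ∂(ENNReal.ofReal (2 * Real.pi) • volume.restrict (Set.Ioi (0 : ℝ))), 0 < p :=
    Measure.ae_smul_measure (ae_restrict_mem measurableSet_Ioi) _
  exact Measure.quasiMeasurePreserving_fst.ae this

theorem ae_sector_pos (k : ℕ × ℕ) :
    ∀ᵐ x ∂sectorMeasure k, (∀ i, 0 < (x.1 i).1) ∧ ∀ j, 0 < (x.2 j).1 := by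
  have h : ∀ n : ℕ, ∀ᵐ x ∂(Measure.pi fun _ : Fin n => modeMeasure), ∀ i, 0 < (x i).1 := fun n =>
    ae_all_iff.2 fun i => (Measure.quasiMeasurePreserving_eval (fun _ => modeMeasure) i).ae ae_modeMeasure_pos
  exact (Measure.quasiMeasurePreserving_fst.ae (h k.1)).and
    (Measure.quasiMeasurePreserving_snd.ae (h k.2))

theorem ae_boseMeasure_pos : ∀ᵐ p ∂boseMeasure, 0 < p :=
  (withDensity_absolutelyContinuous _ _).ae_le (ae_restrict_mem measurableSet_Ioi)

theorem scatteringSymbol_ae_eq {φ φ₀ : ℝ → ℂ} (h : φ =ᵐ[volume] φ₀) :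
    scatteringSymbol φ =ᵐ[configMeasure] scatteringSymbol φ₀ := by
  filter_upwards [ae_config_mul h, ae_config_mul (ae_neg h)] with z h1 h2
  refine Finset.prod_congr rfl fun i _ => Finset.prod_congr rfl fun j _ => ?_
  simp only [pairSymbol, check, h1 i j, h2 i j]

theorem measurable_scatteringSymbol {φ : ℝ → ℂ} (hm : Measurable φ) :
    Measurable (scatteringSymbol φ) := by
  have hc := measurable_check hm
  have hp : Measurable fun w : Mode × Mode => pairSymbol φ w.1 w.2 := by
    unfold pairSymbol
    have hw : Measurable fun w : Mode × Mode => w.1.1 * w.2.1 := by fun_prop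
    refine Measurable.ite ?_ (hm.comp hw) (hc.comp hw)
    exact measurableSet_eq_fun (by fun_prop) (by fun_prop)
  refine measurable_config fun k => ?_
  change Measurable fun x : (Fin k.1 → Mode) × (Fin k.2 → Mode) =>
    ∏ i : Fin k.1, ∏ j : Fin k.2, pairSymbol φ (x.1 i) (x.2 j)
  refine Finset.measurable_fun_prod _ fun i _ => Finset.measurable_fun_prod _ fun j _ => ?_
  exact hp.comp (f := fun x : (Fin k.1 → Mode) × (Fin k.2 → Mode) => (x.1 i, x.2 j))
    (by fun_prop)

theorem conj_chargeCoeff_mul_self (x : Fin 2 → Mode) :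
    (starRingEnd ℂ) (chargeCoeff x) * chargeCoeff x = ((‖chargeCoeff x‖ ^ 2 : ℝ) : ℂ) := by
  rw [← Complex.normSq_eq_conj_mul_self, Complex.normSq_eq_norm_sq]

theorem coe_chargeDensity (x : Fin 2 → Mode) :
    ((chargeDensity x : ℝ) : ℂ) = (((2 * Real.pi)⁻¹ : ℝ) : ℂ) ^ 2 *
      ((starRingEnd ℂ) (chargeCoeff x) * chargeCoeff x) := by
  rw [conj_chargeCoeff_mul_self, chargeDensity, NNReal.coe_mul, NNReal.coe_pow, NNReal.coe_pow,
    Real.coe_toNNReal _ (by positivity), coe_nnnorm]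
  push_cast; ring

theorem charge_eq_not {x : Fin 2 → Mode} (hx : chargeCoeff x ≠ 0) : (x 1).2 = !(x 0).2 := by
  by_contra h
  refine hx ?_
  cases h0 : (x 0).2 <;> cases h1 : (x 1).2 <;> simp_all [chargeCoeff]

/-- On pairs of modes of opposite charges the scattering symbol is a function of the total momenta
and the momentum fractions. -/
theorem scatteringSymbol_eq_kernel (φ : ℝ → ℂ) {x y : Fin 2 → Mode} (hx : chargeCoeff x ≠ 0)
    (hy : chargeCoeff y ≠ 0) (hx0 : ∀ i, 0 < (x i).1) (hy0 : ∀ j, 0 < (y j).1) :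
    scatteringSymbol φ ⟨(2, 2), x, y⟩ =
      kernel φ ((pairMap x).1 * (pairMap y).1) ((pairMap x).2, (pairMap y).2) := by
  have hsym : scatteringSymbol φ ⟨(2, 2), x, y⟩ = pairSymbol φ (x 0) (y 0) *
      pairSymbol φ (x 0) (y 1) * (pairSymbol φ (x 1) (y 0) * pairSymbol φ (x 1) (y 1)) := by
    change ∏ i : Fin 2, ∏ j : Fin 2, pairSymbol φ (x i) (y j) = _
    simp only [Fin.prod_univ_two]
  have sx : (x 0).1 + (x 1).1 ≠ 0 := (add_pos (hx0 0) (hx0 1)).ne'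
  have sy : (y 0).1 + (y 1).1 ≠ 0 := (add_pos (hy0 0) (hy0 1)).ne'
  have frac : ∀ s t u v : ℝ, kernel φ (s * t) (u, v) =
      φ ((s * (1 - u)) * (t * (1 - v))) * φ ((s * u) * (t * v)) *
        check φ ((s * (1 - u)) * (t * v)) * check φ ((s * u) * (t * (1 - v))) := by
    intro s t u v
    simp only [kernel]
    ring_nf
  have d1 : ∀ {a b : ℝ}, a + b ≠ 0 → (a + b) * (a / (a + b)) = a := fun h =>
    mul_div_cancel₀ _ h
  have d2 : ∀ {a b : ℝ}, a + b ≠ 0 → (a + b) * (b / (a + b)) = b := fun h =>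
    mul_div_cancel₀ _ h
  have d3 : ∀ {a b : ℝ}, a + b ≠ 0 → (a + b) * (1 - a / (a + b)) = b := fun h => by
    rw [mul_sub, d1 h]; ring
  have d4 : ∀ {a b : ℝ}, a + b ≠ 0 → (a + b) * (1 - b / (a + b)) = a := fun h => by
    rw [mul_sub, d2 h]; ring
  rw [hsym]
  have hx2 := charge_eq_not hx
  have hy2 := charge_eq_not hy
  -- In all four orderings of the charges `pairMap` gives the fraction of the `+` fermion, so only
  -- the order of the four factors changes.
  rcases hx1 : (x 0).2 with _ | _ <;> rcases hy1 : (y 0).2 with _ | _ <;>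
    rw [hx1] at hx2 <;> rw [hy1] at hy2 <;>
    simp only [pairMap, pairSymbol, hx1, hx2, hy1, hy2, if_true, Bool.true_eq_false, Bool.not_true,
      Bool.not_false, Bool.false_eq_true, if_false, frac, d1 sx, d2 sx, d3 sx, d4 sx, d1 sy, d2 sy,
      d3 sy, d4 sy] <;>
    ring

/-- The constants and charge coefficients of the two wave functions combine to `chargeDensity x *
chargeDensity y`. Where a coefficient vanishes both sides are `0`, so the symbol need be computed
only for opposite charges. -/
theorem scatteringSymbol_mul_conj_embedFun_mul (φ : ℝ → ℂ) (Ψ Ψ' : ℝ × ℝ → ℂ) {x y : Fin 2 → Mode}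
    (hx0 : ∀ i, 0 < (x i).1) (hy0 : ∀ j, 0 < (y j).1) :
    scatteringSymbol φ ⟨(2, 2), x, y⟩ *
        ((starRingEnd ℂ) (embedFun Ψ ⟨(2, 2), x, y⟩) * embedFun Ψ' ⟨(2, 2), x, y⟩) =
      (chargeDensity x * chargeDensity y) •
        (kernel φ ((pairMap x).1 * (pairMap y).1) ((pairMap x).2, (pairMap y).2) *
          ((starRingEnd ℂ) (Ψ ((pairMap x).1, (pairMap y).1)) *
            Ψ' ((pairMap x).1, (pairMap y).1))) := by
  rw [NNReal.smul_def, Complex.real_smul, NNReal.coe_mul, Complex.ofReal_mul, coe_chargeDensity,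
    coe_chargeDensity]
  simp only [embedFun, map_mul, Complex.conj_ofReal]
  by_cases hx : chargeCoeff x = 0
  · simp [hx]
  by_cases hy : chargeCoeff y = 0
  · simp [hy]
  rw [scatteringSymbol_eq_kernel φ hx hy hx0 hy0]
  simp only [pairMap]
  push_cast
  ring

/-- The matrix element of `S_φ` between embedded vectors. After passing to total momenta and
fractions, the wave functions do not depend on the fractions, and integrating these out first turns
the kernel into `φ̃`. -/
theorem integral_scatteringSymbol {φ φ₀ : ℝ → ℂ} (he : φ =ᵐ[volume] φ₀) (hm : Measurable φ₀)
    (h1 : ∀ x, ‖φ₀ x‖ = 1) (Ψ Ψ' : BosePair) :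
    ∫ z, scatteringSymbol φ z * ((starRingEnd ℂ) (embedFun Ψ z) * embedFun Ψ' z) ∂configMeasure =
      ∫ w, phiTilde φ (w.1 * w.2) * ((starRingEnd ℂ) (Ψ w) * Ψ' w)
        ∂boseMeasure.prod boseMeasure := by
  have hΨ : Measurable Ψ := (Lp.stronglyMeasurable Ψ).measurable
  have hΨ' : Measurable Ψ' := (Lp.stronglyMeasurable Ψ').measurable
  have hconj := Complex.continuous_conj.measurable
  set g : ℝ × ℝ → ℂ := fun w => (starRingEnd ℂ) (Ψ w) * Ψ' w with hg
  have hgm : Measurable g := (hconj.comp hΨ).mul hΨ'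
  have hgi : Integrable g (boseMeasure.prod boseMeasure) := by
    have := L2.integrable_inner (𝕜 := ℂ) Ψ Ψ'
    simpa [RCLike.inner_apply, mul_comm, hg] using this
  have hkm := measurable_kernel hm
  set H : (ℝ × ℝ) × ℝ × ℝ → ℂ := fun v => kernel φ₀ (v.1.1 * v.1.2) v.2 * g v.1 with hH
  have hHm : Measurable H := by
    refine Measurable.mul ?_ (hgm.comp measurable_fst)
    exact hkm.comp (f := fun v : (ℝ × ℝ) × ℝ × ℝ => (v.1.1 * v.1.2, v.2)) (by fun_prop)
  -- A unimodular kernel times a product of two `L²` functions is integrable over the probability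
  -- space of fractions; this licenses Fubini.
  have hHi : Integrable H ((boseMeasure.prod boseMeasure).prod (unif.prod unif)) := by
    refine (hgi.comp_fst (unif.prod unif)).bdd_mul (c := 1) ?_
      (Eventually.of_forall fun v => (norm_kernel h1 _ _).le)
    exact (hkm.comp (f := fun v : (ℝ × ℝ) × ℝ × ℝ => (v.1.1 * v.1.2, v.2))
      (by fun_prop)).aestronglyMeasurable
  have hmp : MeasurePreserving (fun x : (Fin 2 → Mode) × (Fin 2 → Mode) =>
      (((pairMap x.1).1, (pairMap x.2).1), (pairMap x.1).2, (pairMap x.2).2))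
      (chargeMeasure.prod chargeMeasure)
      ((boseMeasure.prod boseMeasure).prod (unif.prod unif)) :=
    (measurePreserving_prodProdProdComm boseMeasure unif boseMeasure unif).comp
      (measurePreserving_pairMap.prod measurePreserving_pairMap)
  have hdm : Measurable fun x : (Fin 2 → Mode) × (Fin 2 → Mode) =>
      chargeDensity x.1 * chargeDensity x.2 :=
    (measurable_chargeDensity.comp measurable_fst).mul (measurable_chargeDensity.comp measurable_snd)
  calc ∫ z, scatteringSymbol φ z * ((starRingEnd ℂ) (embedFun Ψ z) * embedFun Ψ' z) ∂configMeasure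
      = ∫ z, scatteringSymbol φ₀ z * ((starRingEnd ℂ) (embedFun Ψ z) * embedFun Ψ' z)
          ∂configMeasure := by
        refine integral_congr_ae ?_
        filter_upwards [scatteringSymbol_ae_eq he] with z hz
        rw [hz]
    _ = ∫ x, scatteringSymbol φ₀ ⟨(2, 2), x⟩ *
          ((starRingEnd ℂ) (embedFun Ψ ⟨(2, 2), x⟩) * embedFun Ψ' ⟨(2, 2), x⟩)
            ∂sectorMeasure (2, 2) := by
        refine integral_config_eq_sector (f := fun z => scatteringSymbol φ₀ z *
          ((starRingEnd ℂ) (embedFun Ψ z) * embedFun Ψ' z)) ?_ ?_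
        · exact (measurable_scatteringSymbol hm).mul
            ((hconj.comp (measurable_embedFun hΨ)).mul (measurable_embedFun hΨ'))
        · rintro ⟨k, x⟩ hk
          simp only [embedFun_of_ne _ hk, mul_zero]
    _ = ∫ x, (chargeDensity x.1 * chargeDensity x.2) •
          H (((pairMap x.1).1, (pairMap x.2).1), (pairMap x.1).2, (pairMap x.2).2)
            ∂sectorMeasure (2, 2) := by
        refine integral_congr_ae ?_
        filter_upwards [ae_sector_pos (2, 2)] with x hx
        exact scatteringSymbol_mul_conj_embedFun_mul φ₀ Ψ Ψ' hx.1 hx.2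
    _ = ∫ x, H (((pairMap x.1).1, (pairMap x.2).1), (pairMap x.1).2, (pairMap x.2).2)
            ∂chargeMeasure.prod chargeMeasure := by
        rw [prod_chargeMeasure]
        exact (integral_withDensity_eq_integral_smul hdm _).symm
    _ = ∫ v, H v ∂(boseMeasure.prod boseMeasure).prod (unif.prod unif) := by
        rw [← hmp.map_eq, integral_map hmp.measurable.aemeasurable hHm.aestronglyMeasurable]
    _ = ∫ w, phiTilde φ (w.1 * w.2) * g w ∂boseMeasure.prod boseMeasure := by
        rw [integral_prod _ hHi]
        refine integral_congr_ae ?_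
        -- Bosonic momenta are almost everywhere positive, so the averaging formula for `φ̃`, which
        -- fails at `0`, applies to their product.
        filter_upwards [Measure.quasiMeasurePreserving_fst.ae ae_boseMeasure_pos,
          Measure.quasiMeasurePreserving_snd.ae ae_boseMeasure_pos] with w hw1 hw2
        rw [phiTilde_eq_integral he hm h1 (mul_pos hw1 hw2).ne', ← integral_mul_const]

theorem adjoint_embed_scatteringOp_embed {φ : ℝ → ℂ} (h : IsInner φ) :
    ContinuousLinearMap.adjoint embed.toContinuousLinearMap ∘L scatteringOp φ h ∘L
      embed.toContinuousLinearMap = mulOp _ (memLp_phiTilde_mul h) := by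
  obtain ⟨φ₀, hm, he, h1⟩ := h.exists_measurable
  refine ContinuousLinearMap.ext fun Ψ' => ext_inner_left ℂ fun Ψ => ?_
  rw [inner_mulOp, ← integral_scatteringSymbol he hm h1]
  simp only [ContinuousLinearMap.comp_apply, ContinuousLinearMap.adjoint_inner_right]
  change inner ℂ ((embed Ψ : FermiFock) : UFock)
    (mulOp (scatteringSymbol φ) (memLp_scatteringSymbol h) (embed Ψ' : FermiFock)) = _
  rw [inner_mulOp]
  refine integral_congr_ae ?_
  filter_upwards [coeFn_embed Ψ, coeFn_embed Ψ'] with z h2 h3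
  rw [h2, h3]

/-- For an isometry `ι* ι = 1`, so `F - ι ι* F` is orthogonal to the range of `ι`, which
characterizes the projection. -/
theorem boseProj_eq : boseProj = embed.toContinuousLinearMap ∘L
    ContinuousLinearMap.adjoint embed.toContinuousLinearMap := by
  refine ContinuousLinearMap.ext fun F => ?_
  refine Submodule.eq_starProjection_of_mem_of_inner_eq_zero ⟨_, rfl⟩ ?_
  rintro _ ⟨Ψ, rfl⟩
  change inner ℂ (F - embed (ContinuousLinearMap.adjoint embed.toContinuousLinearMap F))
    (embed Ψ) = 0
  rw [inner_sub_left, LinearIsometry.inner_map_map, ContinuousLinearMap.adjoint_inner_left,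
    sub_eq_zero]
  rfl

theorem boseProj_scatteringOp_boseProj {φ : ℝ → ℂ} (h : IsInner φ) :
    boseProj ∘L scatteringOp φ h ∘L boseProj =
      embed.toContinuousLinearMap ∘L mulOp _ (memLp_phiTilde_mul h) ∘L
        ContinuousLinearMap.adjoint embed.toContinuousLinearMap := by
  rw [boseProj_eq, ← adjoint_embed_scatteringOp_embed h]
  rfl

end FermiScattering

theorem mainTheorem9 (φ : ℝ → ℂ) (hφ : FermiScattering.IsInner φ) :
    (∃ T : FermiScattering.BosePair →L[ℂ] FermiScattering.BosePair,
      FermiScattering.IsFunctionOfMomentumProduct (FermiScattering.phiTilde φ) T ∧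
      FermiScattering.boseProj ∘L FermiScattering.scatteringOp φ hφ ∘L FermiScattering.boseProj =
        FermiScattering.embed.toContinuousLinearMap ∘L T ∘L
          ContinuousLinearMap.adjoint FermiScattering.embed.toContinuousLinearMap) ∧
    (∃ F : ℂ → ℂ, DifferentiableOn ℂ F FermiScattering.upperHalf ∧
      (∀ z ∈ FermiScattering.upperHalf, ‖F z‖ ≤ 1) ∧
      ∀ p : ℝ, p ≠ 0 → Tendsto (fun y : ℝ => F (p + y * Complex.I)) (𝓝[>] 0)
        (𝓝 (FermiScattering.phiTilde φ p))) ∧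
    ∀ p : ℝ, ‖FermiScattering.phiTilde φ p‖ ≤ 1 :=
  ⟨⟨_, FermiScattering.isFunctionOfMomentumProduct_mulOp hφ,
    FermiScattering.boseProj_scatteringOp_boseProj hφ⟩,
    FermiScattering.exists_extension_phiTilde hφ, FermiScattering.norm_phiTilde_le hφ⟩
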